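/- Let $\Bbbk$ be a commutative ring and let $A$ and $B$ be $\Bbbk$-algebras, $A$ left-noetherian and $B$ right-noetherian. Modules are left modules, and $R^\circ$ denotes the opposite of a ring $R$. Complexes are graded homologically. The projective dimension $\operatorname{pd}_R X$ of a complex $X$ is the infimum of $\sup\{i \mid P_i\neq 0\}$ over all semi-projective resolutions $P\xrightarrow{\simeq}X$, and the injective dimension $\operatorname{id}_R X$ is the infimum of $\sup\{i\mid I_{-i}\neq 0\}$ over all semi-injective resolutions $X\xrightarrow{\simeq} I$; both take values in $\mathbb Z\cup\{\pm\infty\}$. A left-noetherian ring $R$ *satisfies* (AC) if for every finitely generated $R$-module $M$ there is an integer $b\ge 0$ such that for every finitely generated $R$-module $N$: if $\operatorname{Ext}^i_R(M,N)=0$ for all $i\gg 0$, then $\operatorname{Ext}^i_R(M,N)=0$ for all $i>b$. A *dualizing complex* for the pair $\langle A,B\rangle$ is a complex $D$ of $A$-$B$-bimodules (that is, of $A\otimes_\Bbbk B^\circ$-modules) such that: (1) the homology of $D$ is bounded and degreewise finitely generated over $A$ and over $B^\circ$; (2) there is a quasi-isomorphism of complexes of bimodules $P\to D$, where $P$ is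 right-bounded and consists of modules that are projective over $A$ and over $B^\circ$; (3) there is a quasi-isomorphism of complexes of bimodules $D\to I$, where $I$ is bounded and consists of modules that are injective over $A$ and over $B^\circ$; (4) the homothety morphisms $A\to\operatorname{RHom}_{B^\circ}(D,D)$ and $B\to\operatorname{RHom}_A(D,D)$ are isomorphisms in homology. If $A$ is two-sided noetherian, a dualizing complex for $\langle A,A\rangle$ is called a dualizing complex for $A$. **Proposition.** Let $D$ be a dualizing complex for $\langle A,B\rangle$. The complexes $\operatorname{RHom}_A(D,A)$ and $\operatorname{RHom}_{B^\circ}(D,B)$ are isomorphic in the derived category $\mathsf D(\Bbbk)$, and when they are homologically bounded, the following hold: (a) If $A$ satisfies (AC), then $\operatorname{id}_{A^\circ}A$ and $\operatorname{id}_{B^\circ}B$ are at most $\operatorname{pd}_A D+\operatorname{id}_{B^\circ}D<\infty$. (b) If $B^\circ$ satisfies (AC), then $\operatorname{id}_A A$ and $\operatorname{id}_B B$ are at most $\operatorname{pd}_{B^\circ}D+\operatorname{id}_A D<\infty$. In particular, if $A$ is a two-sided noetherian $\Bbbk$-algebra that has a dualizing complex, and both $A$ and $A^\circ$ satisfy (AC),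 then $\operatorname{id}_A A<\infty$ if and only if $\operatorname{id}_{A^\circ}A<\infty$. -/

import Mathlib

/-!
All complexes are cochain complexes indexed by `ℤ`.  A homologically graded complex
`⋯ → M_{i+1} → M_i → M_{i-1} → ⋯` is the cochain complex whose object in degree `-i` is `M_i`.
Modules are left modules; right `B`-modules are modules over `Bᵐᵒᵖ`, and `A`-`B`-bimodules on which
`k` acts centrally are modules over `A ⊗[k] Bᵐᵒᵖ`.
-/

open CategoryTheory

open scoped TensorProduct

universe w v u

namespace ACRing

noncomputable section

section Condition

variable (R : Type u) [Ring R]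

/-- Auslander's condition (AC): every finitely generated module `M` has an Auslander bound `b`. -/
def AuslanderCondition : Prop :=
  ∀ M : ModuleCat.{u} R, Module.Finite R M → ∃ b : ℕ, ∀ N : ModuleCat.{u} R, Module.Finite R N →
    (∃ n : ℕ, ∀ i ≥ n, Subsingleton (Abelian.Ext M N i)) →
      ∀ i > b, Subsingleton (Abelian.Ext M N i)

end Condition

section Resolutions

variable {R : Type u} [Ring R]

/-- A projective resolution of a complex `X`: a quasi-isomorphism `P ⟶ X` from a semi-projective
(that is, K-projective and degreewise projective) complex. -/
structure ProjRes (X : CochainComplex (ModuleCat.{u} R) ℤ) where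
  /-- the resolving complex -/
  P : CochainComplex (ModuleCat.{u} R) ℤ
  /-- the quasi-isomorphism -/
  π : P ⟶ X
  projective : ∀ n, Projective (P.X n)
  kProjective : P.IsKProjective
  quasiIso : QuasiIso π

/-- An injective resolution of a complex `X`: a quasi-isomorphism `X ⟶ I` to a semi-injective
(that is, K-injective and degreewise injective) complex. -/
structure InjRes (X : CochainComplex (ModuleCat.{u} R) ℤ) where
  /-- the resolving complex -/
  I : CochainComplex (ModuleCat.{u} R) ℤ
  /-- the quasi-isomorphism -/
  ι : X ⟶ I
  injective : ∀ n, Injective (I.X n)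
  kInjective : I.IsKInjective
  quasiIso : QuasiIso ι

/-- Projective dimension: the infimum over all projective resolutions `P` of
`sup {i | P_i ≠ 0}`, where `P_i` is the module in cohomological degree `-i`. -/
def pd (X : CochainComplex (ModuleCat.{u} R) ℤ) : EReal :=
  ⨅ P : ProjRes X, ⨆ (i : ℤ) (_ : ¬ Limits.IsZero (P.P.X (-i))), ((i : ℝ) : EReal)

/-- Injective dimension: the infimum over all injective resolutions `I` of
`sup {i | I_{-i} ≠ 0}`, where `I_{-i}` is the module in cohomological degree `i`. -/
def injDim (X : CochainComplex (ModuleCat.{u} R) ℤ) : EReal :=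
  ⨅ I : InjRes X, ⨆ (i : ℤ) (_ : ¬ Limits.IsZero (I.I.X i)), ((i : ℝ) : EReal)

/-- A module, seen as a complex concentrated in degree `0`. -/
abbrev stalk {R : Type v} [Ring R] (M : ModuleCat.{u} R) : CochainComplex (ModuleCat.{u} R) ℤ :=
  (HomologicalComplex.single (ModuleCat.{u} R) (ComplexShape.up ℤ) 0).obj M

/-- The left module `R` over `R`, as a complex. -/
abbrev leftRegular (R : Type u) [Ring R] : CochainComplex (ModuleCat.{u} R) ℤ :=
  stalk (ModuleCat.of R R)

/-- The right module `R` over `R`, as a complex of modules over the opposite ring. -/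
abbrev rightRegular (R : Type u) [Ring R] : CochainComplex (ModuleCat.{u} Rᵐᵒᵖ) ℤ :=
  stalk (ModuleCat.of Rᵐᵒᵖ R)

/-- A right-bounded complex of projective modules is a projective resolution of every complex to
which it has a quasi-isomorphism. -/
def ProjRes.ofBounded {X P : CochainComplex (ModuleCat.{u} R) ℤ} (π : P ⟶ X)
    (hP : ∀ n, Projective (P.X n)) (b : ℤ) (hb : P.IsStrictlyLE b) (hπ : QuasiIso π) :
    ProjRes X where
  P := P
  π := π
  projective := hP
  kProjective := P.isKProjective_of_projective b
  quasiIso := hπ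

end Resolutions

section RHom

variable (k : Type v) [CommRing k]

open scoped ModuleCat.Algebra in
/-- The `Hom` complex of two complexes of modules over a `k`-algebra, as a complex of
`k`-modules; in degree `n` it is `∏ p, Hom (X^p, Y^(p+n))`. -/
def homComplex {R : Type u} [Ring R] [Algebra k R] (X Y : CochainComplex (ModuleCat.{u} R) ℤ) :
    CochainComplex (ModuleCat.{u} k) ℤ where
  X n := ModuleCat.of k (CochainComplex.HomComplex.Cochain X Y n)
  d i j := ModuleCat.ofHom (CochainComplex.HomComplex.δ_hom k X Y i j)
  shape i j hij := by
    ext : 2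
    simp [CochainComplex.HomComplex.δ_shape _ _ hij]
  d_comp_d' i j l _ _ := by
    ext : 2
    simp [CochainComplex.HomComplex.δ_δ]

open Classical ZeroObject in
/-- The right derived `Hom` complex `RHom_R (X, Y)` in the derived category of `k`: the `Hom` complex
`Hom_R (P, Y)` for a chosen projective resolution `P` of `X`.  (The object does not depend on the
choice, up to isomorphism, and every complex of modules has a projective resolution, so that
the second case never occurs.) -/
def RHom [HasDerivedCategory.{w} (ModuleCat.{u} k)] {R : Type u} [Ring R] [Algebra k R]
    (X Y : CochainComplex (ModuleCat.{u} R) ℤ) : DerivedCategory (ModuleCat.{u} k) :=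
  if h : Nonempty (ProjRes X) then DerivedCategory.Q.obj (homComplex k h.some.P Y) else DerivedCategory.Q.obj 0

variable {k} in
/-- An object of the derived category is homologically bounded if its homology vanishes in all but
finitely many degrees. -/
def HomologicallyBounded [HasDerivedCategory.{w} (ModuleCat.{u} k)]
    (Z : DerivedCategory (ModuleCat.{u} k)) : Prop :=
  ∃ a b : ℤ, ∀ n : ℤ, n < a ∨ b < n →
    Limits.IsZero ((DerivedCategory.homologyFunctor (ModuleCat.{u} k) n).obj Z)

end RHom

section Homothety

variable {k : Type v} [CommRing k] {R S T : Type u} [Ring R] [Ring S] [Ring T]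
  [Algebra k R] [Algebra k S] [Algebra k T]

/-- Restriction of scalars is exact. -/
lemma restrictScalars_preservesHomology (g : S →+* T) :
    (ModuleCat.restrictScalars.{u} g).PreservesHomology :=
  Functor.preservesHomology_of_map_exact _ fun Z hZ => by
    rw [ShortComplex.moduleCat_exact_iff] at hZ ⊢
    exact hZ

/-- Restriction of scalars for complexes of modules. -/
abbrev restrict (g : S →ₐ[k] T) (X : CochainComplex (ModuleCat.{u} T) ℤ) :
    CochainComplex (ModuleCat.{u} S) ℤ :=
  ((ModuleCat.restrictScalars (g : S →+* T)).mapHomologicalComplex (ComplexShape.up ℤ)).obj X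

/-- Let `M` be a `T`-module and let the images of `f : R → T` and `g : S → T` commute.  Then
multiplication by `r : R` is an `S`-linear endomorphism of `M`. -/
def smulEnd (f : R →ₐ[k] T) (g : S →ₐ[k] T) (h : ∀ r s, Commute (f r) (g s))
    (M : ModuleCat.{u} T) (r : R) :
    (ModuleCat.restrictScalars (g : S →+* T)).obj M ⟶
      (ModuleCat.restrictScalars (g : S →+* T)).obj M :=
  ModuleCat.ofHom (X := (ModuleCat.restrictScalars (g : S →+* T)).obj M)
    (Y := (ModuleCat.restrictScalars (g : S →+* T)).obj M)
    { toFun := fun m => (f r • (show M from m) : M)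
      map_add' := fun x y => smul_add (f r) (show M from x) (show M from y)
      map_smul' := fun s m => by
        change (f r • (g s • (show M from m)) : M) = g s • (f r • (show M from m))
        rw [← mul_smul, ← mul_smul, (h r s).eq] }

/-- Multiplication by `r : R`, as an endomorphism of a complex. -/
def smulEndComplex (f : R →ₐ[k] T) (g : S →ₐ[k] T) (h : ∀ r s, Commute (f r) (g s))
    (X : CochainComplex (ModuleCat.{u} T) ℤ) (r : R) : restrict g X ⟶ restrict g X where
  f n := smulEnd f g h (X.X n) r
  comm' i j _ := by
    ext m
    exact ((X.d i j).hom.map_smul (f r) (show X.X i from m))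

open scoped ModuleCat.Algebra in
/-- The map `R → Hom_S (X, X)^0` which sends `r` to multiplication by `r`. -/
def homothetyLinear (f : R →ₐ[k] T) (g : S →ₐ[k] T) (h : ∀ r s, Commute (f r) (g s))
    (X : CochainComplex (ModuleCat.{u} T) ℤ) :
    R →ₗ[k] CochainComplex.HomComplex.Cochain (restrict g X) (restrict g X) 0 where
  toFun r := CochainComplex.HomComplex.Cochain.ofHom (smulEndComplex f g h X r)
  map_add' r s := by
    ext p m
    simp only [CochainComplex.HomComplex.Cochain.ofHom_v,
      CochainComplex.HomComplex.Cochain.add_v]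
    change (f (r + s) • (show X.X p from m) : X.X p) =
      f r • (show X.X p from m) + f s • (show X.X p from m)
    rw [map_add, add_smul]
  map_smul' c r := by
    ext p m
    simp only [CochainComplex.HomComplex.Cochain.ofHom_v,
      CochainComplex.HomComplex.Cochain.smul_v]
    change (f (c • r) • (show X.X p from m) : X.X p) =
      g (algebraMap k S c) • (f r • (show X.X p from m))
    rw [map_smul, Algebra.smul_def, mul_smul, AlgHom.commutes]

open scoped ModuleCat.Algebra in
/-- The homothety morphism `R ⟶ Hom_S (X, X)`, a morphism of complexes of `k`-modules. -/
def homothety (f : R →ₐ[k] T) (g : S →ₐ[k] T) (h : ∀ r s, Commute (f r) (g s))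
    (X : CochainComplex (ModuleCat.{u} T) ℤ) :
    stalk (ModuleCat.of k R) ⟶ homComplex k (restrict g X) (restrict g X) :=
  HomologicalComplex.mkHomFromSingle (ModuleCat.ofHom (homothetyLinear f g h X)) (by
    intro n _
    ext r
    exact CochainComplex.HomComplex.δ_ofHom (smulEndComplex f g h X r))

end Homothety

section Dualizing

variable (k : Type v) [CommRing k] (A B : Type u) [Ring A] [Ring B] [Algebra k A] [Algebra k B]

/-- The structure map `A → A ⊗ Bᵐᵒᵖ`. -/
abbrev inA : A →ₐ[k] A ⊗[k] Bᵐᵒᵖ := Algebra.TensorProduct.includeLeft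

/-- The structure map `Bᵐᵒᵖ → A ⊗ Bᵐᵒᵖ`. -/
abbrev inB : Bᵐᵒᵖ →ₐ[k] A ⊗[k] Bᵐᵒᵖ := Algebra.TensorProduct.includeRight

lemma commute_inA_inB (a : A) (b : Bᵐᵒᵖ) : Commute (inA k A B a) (inB k A B b) := by
  simp [Commute, SemiconjBy]

variable {A B}

/-- The complex of left `A`-modules underlying a complex of bimodules. -/
abbrev overA (X : CochainComplex (ModuleCat.{u} (A ⊗[k] Bᵐᵒᵖ)) ℤ) :
    CochainComplex (ModuleCat.{u} A) ℤ :=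
  restrict (inA k A B) X

/-- The complex of right `B`-modules underlying a complex of bimodules. -/
abbrev overB (X : CochainComplex (ModuleCat.{u} (A ⊗[k] Bᵐᵒᵖ)) ℤ) :
    CochainComplex (ModuleCat.{u} Bᵐᵒᵖ) ℤ :=
  restrict (inB k A B) X

/-- A quasi-isomorphism of complexes of bimodules `P ⟶ D`, where `P` is right-bounded and consists of
bimodules that are projective on both sides. -/
structure BiprojRes (D : CochainComplex (ModuleCat.{u} (A ⊗[k] Bᵐᵒᵖ)) ℤ) where
  /-- the resolving complex -/
  P : CochainComplex (ModuleCat.{u} (A ⊗[k] Bᵐᵒᵖ)) ℤ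
  /-- the quasi-isomorphism -/
  π : P ⟶ D
  quasiIso : QuasiIso π
  bounded : ∃ b : ℤ, P.IsStrictlyLE b
  projective_left : ∀ n, Projective ((overA k P).X n)
  projective_right : ∀ n, Projective ((overB k P).X n)

variable {k} in
/-- A resolution by bimodules that are projective on both sides is a projective resolution over `A`. -/
def BiprojRes.toLeft {D : CochainComplex (ModuleCat.{u} (A ⊗[k] Bᵐᵒᵖ)) ℤ} (P : BiprojRes k D) :
    ProjRes (overA k D) :=
  haveI := P.quasiIso
  haveI := P.bounded.choose_spec
  haveI := restrictScalars_preservesHomology (inA k A B : A →+* A ⊗[k] Bᵐᵒᵖ)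
  ProjRes.ofBounded (((ModuleCat.restrictScalars (inA k A B : A →+* A ⊗[k] Bᵐᵒᵖ)).mapHomologicalComplex
    (ComplexShape.up ℤ)).map P.π) P.projective_left P.bounded.choose inferInstance inferInstance

variable {k} in
/-- A resolution by bimodules that are projective on both sides is a projective resolution over
`Bᵐᵒᵖ`. -/
def BiprojRes.toRight {D : CochainComplex (ModuleCat.{u} (A ⊗[k] Bᵐᵒᵖ)) ℤ} (P : BiprojRes k D) :
    ProjRes (overB k D) :=
  haveI := P.quasiIso
  haveI := P.bounded.choose_spec
  haveI := restrictScalars_preservesHomology (inB k A B : Bᵐᵒᵖ →+* A ⊗[k] Bᵐᵒᵖ)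
  ProjRes.ofBounded (((ModuleCat.restrictScalars (inB k A B : Bᵐᵒᵖ →+* A ⊗[k] Bᵐᵒᵖ)).mapHomologicalComplex
    (ComplexShape.up ℤ)).map P.π) P.projective_right P.bounded.choose inferInstance inferInstance

/-- A quasi-isomorphism of complexes of bimodules `D ⟶ I`, where `I` is bounded and consists of
bimodules that are injective on both sides. -/
structure BiinjRes (D : CochainComplex (ModuleCat.{u} (A ⊗[k] Bᵐᵒᵖ)) ℤ) where
  /-- the resolving complex -/
  I : CochainComplex (ModuleCat.{u} (A ⊗[k] Bᵐᵒᵖ)) ℤ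
  /-- the quasi-isomorphism -/
  ι : D ⟶ I
  quasiIso : QuasiIso ι
  bounded : ∃ a b : ℤ, I.IsStrictlyGE a ∧ I.IsStrictlyLE b
  injective_left : ∀ n, Injective ((overA k I).X n)
  injective_right : ∀ n, Injective ((overB k I).X n)

/-- `D` is a dualizing complex for the pair `⟨A, B⟩`.  The derived endomorphism complexes
`RHom_{Bᵐᵒᵖ} (D, D)` and `RHom_A (D, D)` in the homothety conditions are computed as `Hom (P, P)`,
where `P` is a resolution of `D` that is projective on both sides; the second homothety is
indexed by `Bᵐᵒᵖ`, which as a `k`-module is `B`, with `MulOpposite.op b` acting by right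
multiplication by `b`. -/
structure IsDualizingComplex (D : CochainComplex (ModuleCat.{u} (A ⊗[k] Bᵐᵒᵖ)) ℤ) : Prop where
  bounded : ∃ a b : ℤ, D.IsGE a ∧ D.IsLE b
  finite_left : ∀ n, Module.Finite A ((overA k D).homology n)
  finite_right : ∀ n, Module.Finite Bᵐᵒᵖ ((overB k D).homology n)
  biinjective : Nonempty (BiinjRes k D)
  biprojective : ∃ P : BiprojRes k D,
    QuasiIso (homothety (inA k A B) (inB k A B) (commute_inA_inB k A B) P.P) ∧
    QuasiIso (homothety (inB k A B) (inA k A B)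
      (fun b a => (commute_inA_inB k A B a b).symm) P.P)

end Dualizing

end

end ACRing

/-! The homothety isomorphisms say that `A ≃ RHom_{B°}(D, D)` and `B ≃ RHom_A(D, D)`. Substituting
them and exchanging the two arguments of bilinear maps gives `RHom_A(D, A) ≃ RHom_A(D, RHom_{B°}(D,
D)) ≃ RHom_{B°}(D, RHom_A(D, D)) ≃ RHom_{B°}(D, B)` (`swapIso`,
`nonempty_iso_Q_homComplex_regular`).

For (a), the first point is that `pd_A D` is finite. Over `A`, `D` has no high self-extensions,
because `RHom_A(D, D) ≃ B` lives in degree 0, and no high extensions by `A`, because `RHom_A(D, A)`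
is bounded. Killing homology from the top with finitely generated free modules replaces `D` by a
finitely generated module `M` with the same two properties (`exists_finite_module`). The finitely
generated `N` with `Ext^i(M, N) = 0` for `i ≫ 0` contain `M` and are closed under syzygies. By (AC)
a single `b` gives `Ext^{b+1}(M, N) = 0` for all of them, so by dimension shifting `Ext^1(Ω^b M,
Ω^{b+1} M) = 0`: the `b`-th syzygy is projective (`hasProjectiveDimensionLT_of_auslanderCondition`).

The second point is the bound. Let `P → D` and `D → I` be the resolutions by bimodules. Truncating
`P` below at `-pd_A D` keeps it projective over `A`, and truncating `I` above at `id_{B°} D` keeps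
it injective over `B°`; both stay complexes of bimodules. With `P'` and `I'` the truncations,
`Hom_{B°}(P', I')` is a bounded complex of injective `A°`-modules quasi-isomorphic to `A`, and
`Hom_A(P', I')` is a bounded complex of injective `B°`-modules quasi-isomorphic to `B`. Both vanish
above degree `pd_A D + id_{B°} D` (`injDim_stalk_le_of_source`, `injDim_stalk_le_of_target`).

Part (b) is (a) with `A` and `B°` exchanged. For the last claim, finiteness of `id_A A` makes
`RHom_A(D, A)` bounded, and (a) then bounds the injective dimension on the other side. -/

namespace ACRing

noncomputable section

/-! ### Homology and quasi-isomorphisms in terms of elements -/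

section Elementwise

variable {R : Type v} [Ring R]

lemma exists_cycle (K : CochainComplex (ModuleCat.{u} R) ℤ) (n : ℤ) (x : K.X n)
    (hx : K.d n (n + 1) x = 0) : ∃ c : K.cycles n, K.iCycles n c = x :=
  (ShortComplex.moduleCat_exact_iff _).1 (ShortComplex.exact_of_f_is_kernel
    (ShortComplex.mk _ _ (K.iCycles_d n (n + 1))) (K.cyclesIsKernel n (n + 1) (by simp))) x hx

lemma homologyπ_eq_zero_iff (K : CochainComplex (ModuleCat.{u} R) ℤ) (n : ℤ) (c : K.cycles n) :
    K.homologyπ n c = 0 ↔ ∃ w : K.X (n - 1), K.d (n - 1) n w = K.iCycles n c := by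
  have h := (ShortComplex.moduleCat_exact_iff _).1 (ShortComplex.exact_of_g_is_cokernel
    (ShortComplex.mk _ _ (K.toCycles_comp_homologyπ (n - 1) n))
    (K.homologyIsCokernel (n - 1) n (by simp)))
  have hi (w : K.X (n - 1)) : K.iCycles n (K.toCycles (n - 1) n w) = K.d (n - 1) n w :=
    ConcreteCategory.congr_hom (K.toCycles_i (n - 1) n) w
  constructor
  · intro hc
    obtain ⟨w, hw⟩ := h c hc
    exact ⟨w, by rw [← hi]; exact congrArg _ hw⟩
  · rintro ⟨w, hw⟩
    have : c = K.toCycles (n - 1) n w :=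
      (ModuleCat.mono_iff_injective (K.iCycles n)).1 inferInstance (by rw [hi, hw])
    rw [this]
    exact ConcreteCategory.congr_hom (K.toCycles_comp_homologyπ (n - 1) n) w

lemma isZero_homology_iff (K : CochainComplex (ModuleCat.{u} R) ℤ) (n : ℤ) :
    Limits.IsZero (K.homology n) ↔
      ∀ x : K.X n, K.d n (n + 1) x = 0 → ∃ w : K.X (n - 1), K.d (n - 1) n w = x := by
  rw [ModuleCat.isZero_iff_subsingleton]
  constructor
  · intro h x hx
    obtain ⟨c, rfl⟩ := exists_cycle K n x hx
    exact (homologyπ_eq_zero_iff K n c).1 (Subsingleton.elim _ _)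
  · intro h
    refine ⟨fun a b => ?_⟩
    have key (a : K.homology n) : a = 0 := by
      obtain ⟨c, rfl⟩ := (ModuleCat.epi_iff_surjective (K.homologyπ n)).1 inferInstance a
      exact (homologyπ_eq_zero_iff K n c).2
        (h _ (ConcreteCategory.congr_hom (K.iCycles_d n (n + 1)) c))
    rw [key a, key b]

/-- The elementwise criterion for a family of additive maps compatible with differentials to be a
quasi-isomorphism in degree `n`. -/
def ElementwiseQuasiIsoAt {K₀ K₁ K₂ L₀ L₁ L₂ : Type*} [Zero K₂] [Zero L₂] [Add L₁]
    (dK₀ : K₀ → K₁) (dK₁ : K₁ → K₂) (dL₀ : L₀ → L₁) (dL₁ : L₁ → L₂) (φ : K₁ → L₁) : Prop :=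
  (∀ y, dL₁ y = 0 → ∃ x, dK₁ x = 0 ∧ ∃ z, φ x + dL₀ z = y) ∧
    ∀ x, dK₁ x = 0 → (∃ z, dL₀ z = φ x) → ∃ w, dK₀ w = x

/-- The criterion mentions only the additive groups and the differentials. One verification for a
`Hom` complex therefore serves for all its module structures, over `k` or over a ring acting on one
of the arguments. -/
lemma quasiIso_iff_elementwise {K L : CochainComplex (ModuleCat.{u} R) ℤ} (φ : K ⟶ L) :
    QuasiIso φ ↔ ∀ n, ElementwiseQuasiIsoAt (K.d (n - 1) n) (K.d n (n + 1)) (L.d (n - 1) n)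
      (L.d n (n + 1)) (φ.f n) := by
  rw [quasiIso_iff]
  refine forall_congr' fun n => ?_
  rw [quasiIsoAt_iff_isIso_homologyMap, ConcreteCategory.isIso_iff_bijective]
  have hπ (c : K.cycles n) : HomologicalComplex.homologyMap φ n (K.homologyπ n c) =
      L.homologyπ n (HomologicalComplex.cyclesMap φ n c) :=
    ConcreteCategory.congr_hom (HomologicalComplex.homologyπ_naturality φ n) c
  have hi (c : K.cycles n) : L.iCycles n (HomologicalComplex.cyclesMap φ n c) =
      φ.f n (K.iCycles n c) :=
    ConcreteCategory.congr_hom (HomologicalComplex.cyclesMap_i φ n) c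
  have hd (M : CochainComplex (ModuleCat.{u} R) ℤ) (c : M.cycles n) :
      M.d n (n + 1) (M.iCycles n c) = 0 :=
    ConcreteCategory.congr_hom (M.iCycles_d n (n + 1)) c
  have hs (M : CochainComplex (ModuleCat.{u} R) ℤ) : Function.Surjective (M.homologyπ n) :=
    (ModuleCat.epi_iff_surjective _).1 inferInstance
  constructor
  · rintro ⟨h₁, h₂⟩
    refine ⟨fun y hy => ?_, fun x hx hz => ?_⟩
    · obtain ⟨c, rfl⟩ := exists_cycle L n y hy
      obtain ⟨a, ha⟩ := h₂ (L.homologyπ n c)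
      obtain ⟨b, rfl⟩ := hs K a
      refine ⟨K.iCycles n b, hd _ _, ?_⟩
      have : L.homologyπ n (c - HomologicalComplex.cyclesMap φ n b) = 0 := by
        rw [map_sub, ← ha, hπ, sub_self]
      obtain ⟨w, hw⟩ := (homologyπ_eq_zero_iff _ _ _).1 this
      exact ⟨w, by rw [hw, map_sub, hi]; abel⟩
    · obtain ⟨c, rfl⟩ := exists_cycle K n x hx
      rw [← homologyπ_eq_zero_iff]
      apply h₁
      rw [map_zero, hπ, homologyπ_eq_zero_iff, hi]
      exact hz
  · rintro ⟨h₁, h₂⟩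
    refine ⟨(injective_iff_map_eq_zero _).2 fun a ha => ?_, fun b => ?_⟩
    · obtain ⟨c, rfl⟩ := hs K a
      rw [homologyπ_eq_zero_iff]
      rw [hπ, homologyπ_eq_zero_iff, hi] at ha
      exact h₂ _ (hd _ _) ha
    · obtain ⟨c, rfl⟩ := hs L b
      obtain ⟨x, hx, z, hz⟩ := h₁ _ (hd _ c)
      obtain ⟨e, rfl⟩ := exists_cycle K n x hx
      refine ⟨K.homologyπ n e, ?_⟩
      rw [hπ, ← sub_eq_zero, ← map_sub, homologyπ_eq_zero_iff]
      refine ⟨-z, ?_⟩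
      rw [map_sub, hi, ← hz, map_neg]
      abel

end Elementwise

/-! ### `Hom` complexes and morphisms in the derived category -/

section DerivedHom

open CochainComplex HomComplex

variable {C : Type*} [Category* C] [Abelian C]

attribute [local instance] HasDerivedCategory.standard

/-- The complex `Hom (X, Y)` computes the morphisms in the derived category from `X` to the shifts
of `Y`. -/
def ComputesRHom (X Y : CochainComplex C ℤ) : Prop :=
  ∀ n : ℤ, Function.Bijective (fun c : CohomologyClass X Y n =>
    DerivedCategory.Qh.map (CohomologyClass.toHom c))

lemma computesRHom_of_isKProjective (X Y : CochainComplex C ℤ) [X.IsKProjective] :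
    ComputesRHom X Y := fun n =>
  (CochainComplex.IsKProjective.Qh_map_bijective X _).comp (CohomologyClass.toHom_bijective X Y n)

lemma computesRHom_of_isKInjective (X Y : CochainComplex C ℤ) [Y.IsKInjective] :
    ComputesRHom X Y := fun n =>
  (CochainComplex.IsKInjective.Qh_map_bijective _ (Y⟦n⟧)).comp
    (CohomologyClass.toHom_bijective X Y n)

variable {X X' Y Y' : CochainComplex C ℤ}

/-- The map on cochains induced by morphisms of complexes in both variables. -/
def cochainMap (a : X' ⟶ X) (b : Y ⟶ Y') (n : ℤ) (z : Cochain X Y n) : Cochain X' Y' n :=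
  ((Cochain.ofHom a).comp z (zero_add n)).comp (Cochain.ofHom b) (add_zero n)

lemma cochainMap_v (a : X' ⟶ X) (b : Y ⟶ Y') (n : ℤ) (z : Cochain X Y n) (p q : ℤ)
    (h : p + n = q) : (cochainMap a b n z).v p q h = a.f p ≫ z.v p q h ≫ b.f q := by
  simp [cochainMap]

lemma cochainMap_add (a : X' ⟶ X) (b : Y ⟶ Y') (n : ℤ) (z₁ z₂ : Cochain X Y n) :
    cochainMap a b n (z₁ + z₂) = cochainMap a b n z₁ + cochainMap a b n z₂ := by
  simp [cochainMap]

lemma δ_cochainMap (a : X' ⟶ X) (b : Y ⟶ Y') (n m : ℤ) (z : Cochain X Y n) :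
    δ n m (cochainMap a b n z) = cochainMap a b m (δ n m z) := by
  simp [cochainMap]

lemma Qh_map_toHom_cochainMap (a : X' ⟶ X) (b : Y ⟶ Y') (n : ℤ) (z : Cocycle X Y n) :
    DerivedCategory.Qh.map (CohomologyClass.toHom (CohomologyClass.mk
      ((z.precomp a).postcomp b))) =
    DerivedCategory.Qh.map ((HomotopyCategory.quotient C _).map a) ≫
      DerivedCategory.Qh.map (CohomologyClass.toHom (CohomologyClass.mk z)) ≫
      DerivedCategory.Qh.map ((HomotopyCategory.quotient C _).map (b⟦n⟧')) := by
  simp only [CohomologyClass.toHom_mk, Cocycle.equivHomShift_symm_precomp,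
    Cocycle.equivHomShift_symm_postcomp, Functor.map_comp, Category.assoc]

instance (a : X ⟶ Y) [QuasiIso a] :
    IsIso (DerivedCategory.Qh.map ((HomotopyCategory.quotient C _).map a)) := by
  have := (NatIso.isIso_map_iff (DerivedCategory.quotientCompQhIso C) a).2 inferInstance
  exact this

/-- Cohomology classes on both sides are morphisms in the derived category, where the map becomes
composition with the isomorphisms given by `a` and `b⟦n⟧'`. Each pair may compute `RHom` for its own
reason, a K-projective source or a K-injective target, so the two kinds of model can be compared. -/
lemma elementwiseQuasiIsoAt_cochainMap (hXY : ComputesRHom X Y) (hXY' : ComputesRHom X' Y')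
    (a : X' ⟶ X) (b : Y ⟶ Y') [QuasiIso a] [QuasiIso b] (n : ℤ) :
    ElementwiseQuasiIsoAt (δ (n - 1) n) (δ n (n + 1)) (δ (n - 1) n) (δ n (n + 1))
      (cochainMap a b n) := by
  have : QuasiIso (b⟦n⟧') := by
    rw [← DerivedCategory.isIso_Q_map_iff_quasiIso]
    have : IsIso ((DerivedCategory.Q.map b)⟦n⟧') := inferInstance
    exact (NatIso.isIso_map_iff (DerivedCategory.Q.commShiftIso (C := CochainComplex C ℤ) n) b).2
      this
  have hv (z : Cocycle X Y n) : ((z.precomp a).postcomp b).1 = cochainMap a b n z.1 := rfl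
  constructor
  · intro y hy
    obtain ⟨c, hc⟩ := (hXY n).2 (inv (DerivedCategory.Qh.map ((HomotopyCategory.quotient C _).map a))
      ≫ DerivedCategory.Qh.map (CohomologyClass.toHom (CohomologyClass.mk (Cocycle.mk y _ rfl hy)))
      ≫ inv (DerivedCategory.Qh.map ((HomotopyCategory.quotient C _).map (b⟦n⟧'))))
    obtain ⟨z, rfl⟩ := c.mk_surjective
    refine ⟨z.1, z.δ_eq_zero _, ?_⟩
    have : CohomologyClass.mk ((z.precomp a).postcomp b) = CohomologyClass.mk (Cocycle.mk y _ rfl hy) := by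
      apply (hXY' n).1
      dsimp only at hc ⊢
      rw [Qh_map_toHom_cochainMap, hc]
      simp
    rw [eq_comm, ← sub_eq_zero, ← CohomologyClass.mk_sub, CohomologyClass.mk_eq_zero_iff,
      mem_coboundaries_iff _ (n - 1) (by simp)] at this
    obtain ⟨β, hβ⟩ := this
    refine ⟨β, ?_⟩
    rw [hβ, ← hv]
    simp
  · rintro x hx ⟨z, hz⟩
    have : CohomologyClass.mk (Cocycle.mk x _ rfl hx) = 0 := by
      apply (hXY n).1
      have h := Qh_map_toHom_cochainMap a b n (Cocycle.mk x _ rfl hx)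
      have h0 : CohomologyClass.mk (((Cocycle.mk x _ rfl hx).precomp a).postcomp b) = 0 := by
        rw [CohomologyClass.mk_eq_zero_iff, mem_coboundaries_iff _ (n - 1) (by simp)]
        exact ⟨z, hz⟩
      rw [h0, map_zero, Functor.map_zero] at h
      dsimp only
      rw [map_zero, Functor.map_zero]
      rw [eq_comm, ← cancel_epi (DerivedCategory.Qh.map ((HomotopyCategory.quotient C _).map a)),
        ← cancel_mono (DerivedCategory.Qh.map ((HomotopyCategory.quotient C _).map (b⟦n⟧'))),
        Category.assoc, Category.assoc, ← h]
      simp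
    rw [CohomologyClass.mk_eq_zero_iff, mem_coboundaries_iff _ (n - 1) (by simp)] at this
    exact this

end DerivedHom

/-! ### Functoriality of the `Hom` complex over `k` -/

section HomComplexMap

open CochainComplex HomComplex

variable (k : Type v) [CommRing k] {R : Type u} [Ring R] [Algebra k R]
  {X X' Y Y' : CochainComplex (ModuleCat.{u} R) ℤ}

open scoped ModuleCat.Algebra in
lemma cochainMap_smul (a : X' ⟶ X) (b : Y ⟶ Y') (n : ℤ) (c : k) (z : Cochain X Y n) :
    cochainMap a b n (c • z) = c • cochainMap a b n z := by
  simp [cochainMap]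

open scoped ModuleCat.Algebra in
/-- The functoriality of `homComplex` in both variables. -/
def homComplexMap (a : X' ⟶ X) (b : Y ⟶ Y') : homComplex k X Y ⟶ homComplex k X' Y' where
  f n := ModuleCat.ofHom
    { toFun := cochainMap a b n
      map_add' := cochainMap_add a b n
      map_smul' := cochainMap_smul k a b n }
  comm' i j _ := by
    ext z : 2
    exact δ_cochainMap a b i j z

lemma quasiIso_homComplexMap (hXY : ComputesRHom X Y) (hXY' : ComputesRHom X' Y')
    (a : X' ⟶ X) (b : Y ⟶ Y') [QuasiIso a] [QuasiIso b] : QuasiIso (homComplexMap k a b) := by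
  rw [quasiIso_iff_elementwise]
  exact elementwiseQuasiIsoAt_cochainMap hXY hXY' a b

end HomComplexMap

/-! ### Rings acting on `Hom` complexes -/

section Action

open CochainComplex HomComplex

variable {S : Type u} [Ring S] {X Y : CochainComplex (ModuleCat.{u} S) ℤ}

/-- `cochainMap` as an additive map. -/
def cochainMapHom {X' Y' : CochainComplex (ModuleCat.{u} S) ℤ} (a : X' ⟶ X) (b : Y ⟶ Y') (n : ℤ) :
    Cochain X Y n →+ Cochain X' Y' n :=
  AddMonoidHom.mk' (cochainMap a b n) (cochainMap_add a b n)

lemma cochainMap_id (n : ℤ) (z : Cochain X Y n) : cochainMap (𝟙 X) (𝟙 Y) n z = z := by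
  ext p q h : 1
  simp [cochainMap_v]

lemma cochainMap_cochainMap {X' Y' X'' Y'' : CochainComplex (ModuleCat.{u} S) ℤ} (a : X' ⟶ X)
    (b : Y ⟶ Y') (a' : X'' ⟶ X') (b' : Y' ⟶ Y'') (n : ℤ) (z : Cochain X Y n) :
    cochainMap a' b' n (cochainMap a b n z) = cochainMap (a' ≫ a) (b ≫ b') n z := by
  ext p q h : 1
  simp [cochainMap_v]

lemma cochainMap_add_left {X' Y' : CochainComplex (ModuleCat.{u} S) ℤ} (a a' : X' ⟶ X)
    (b : Y ⟶ Y') (n : ℤ) (z : Cochain X Y n) :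
    cochainMap (a + a') b n z = cochainMap a b n z + cochainMap a' b n z := by
  ext p q h : 1
  simp [cochainMap_v]

lemma cochainMap_add_right {X' Y' : CochainComplex (ModuleCat.{u} S) ℤ} (a : X' ⟶ X)
    (b b' : Y ⟶ Y') (n : ℤ) (z : Cochain X Y n) :
    cochainMap a (b + b') n z = cochainMap a b n z + cochainMap a b' n z := by
  ext p q h : 1
  simp [cochainMap_v]

/-- An action of a ring on the complex `Hom (X, Y)`. -/
structure CochainAction (Λ : Type u) [Ring Λ] (X Y : CochainComplex (ModuleCat.{u} S) ℤ) where
  /-- the action in each degree -/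
  act (n : ℤ) : Λ →+* AddMonoid.End (Cochain X Y n)
  δ_act (n m : ℤ) (r : Λ) (z : Cochain X Y n) : δ n m (act n r z) = act m r (δ n m z)

variable {Λ : Type u} [Ring Λ]

/-- The module of cochains of degree `n`, over a ring acting on `Hom (X, Y)`. -/
def CochainAction.obj (σ : CochainAction Λ X Y) (n : ℤ) : ModuleCat.{u} Λ :=
  @ModuleCat.of Λ _ (Cochain X Y n) _ (Module.compHom _ (σ.act n))

/-- A linear map between modules of cochains. -/
def CochainAction.homMk {S' : Type u} [Ring S'] {X' Y' : CochainComplex (ModuleCat.{u} S') ℤ}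
    (σ : CochainAction Λ X Y) (σ' : CochainAction Λ X' Y') {n m : ℤ}
    (φ : Cochain X Y n →+ Cochain X' Y' m) (h : ∀ r z, φ (σ.act n r z) = σ'.act m r (φ z)) :
    σ.obj n ⟶ σ'.obj m :=
  ModuleCat.ofHom (X := σ.obj n) (Y := σ'.obj m)
    { toFun := φ
      map_add' := φ.map_add
      map_smul' := h }

/-- The complex `Hom (X, Y)`, as a complex of modules over a ring acting on it. -/
def CochainAction.complex (σ : CochainAction Λ X Y) : CochainComplex (ModuleCat.{u} Λ) ℤ where
  X := σ.obj
  d i j := σ.homMk σ (AddMonoidHom.mk' (δ i j) (δ_add i j)) (fun r z => σ.δ_act i j r z)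
  shape i j hij := by
    ext z
    exact δ_shape i j (fun h => hij h) z
  d_comp_d' i j l _ _ := by
    ext z
    exact δ_δ i j l z

/-- The action on `Hom (X, Y)` coming from an action on `Y`. -/
def CochainAction.ofTarget (X : CochainComplex (ModuleCat.{u} S) ℤ) (ρ : Λ →+* End Y) :
    CochainAction Λ X Y where
  act n :=
    { toFun := fun r => cochainMapHom (𝟙 X) (ρ r) n
      map_one' := AddMonoidHom.ext fun z => by
        rw [map_one]
        exact cochainMap_id n z
      map_mul' := fun r s => AddMonoidHom.ext fun z => by
        change cochainMap _ _ n z = cochainMap _ _ n (cochainMap _ _ n z)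
        rw [map_mul, cochainMap_cochainMap, Category.comp_id, End.mul_def]
      map_zero' := AddMonoidHom.ext fun z => by
        change cochainMap _ _ n z = 0
        rw [map_zero]
        ext p q h : 1
        simp [cochainMap_v]
      map_add' := fun r s => AddMonoidHom.ext fun z => by
        change cochainMap _ _ n z = cochainMap _ _ n z + cochainMap _ _ n z
        rw [map_add]
        exact cochainMap_add_right _ _ _ n z }
  δ_act n m r z := δ_cochainMap _ _ n m z

/-- The action on `Hom (X, Y)` coming from an action on `X`. -/
def CochainAction.ofSource (ρ : Λ →+* (End X)ᵐᵒᵖ) (Y : CochainComplex (ModuleCat.{u} S) ℤ) :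
    CochainAction Λ X Y where
  act n :=
    { toFun := fun r => cochainMapHom (ρ r).unop (𝟙 Y) n
      map_one' := AddMonoidHom.ext fun z => by
        rw [map_one]
        exact cochainMap_id n z
      map_mul' := fun r s => AddMonoidHom.ext fun z => by
        change cochainMap _ _ n z = cochainMap _ _ n (cochainMap _ _ n z)
        rw [map_mul, cochainMap_cochainMap, Category.comp_id, MulOpposite.unop_mul, End.mul_def]
      map_zero' := AddMonoidHom.ext fun z => by
        change cochainMap _ _ n z = 0
        rw [map_zero]
        ext p q h : 1
        simp [cochainMap_v]
      map_add' := fun r s => AddMonoidHom.ext fun z => by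
        change cochainMap _ _ n z = cochainMap _ _ n z + cochainMap _ _ n z
        rw [map_add]
        exact cochainMap_add_left _ _ _ n z }
  δ_act n m r z := δ_cochainMap _ _ n m z

variable {X' Y' : CochainComplex (ModuleCat.{u} S) ℤ}

/-- Morphisms compatible with the actions induce morphisms of complexes of modules. -/
def CochainAction.map (σ : CochainAction Λ X Y) (σ' : CochainAction Λ X' Y') (a : X' ⟶ X)
    (b : Y ⟶ Y')
    (h : ∀ n r z, cochainMap a b n (σ.act n r z) = σ'.act n r (cochainMap a b n z)) :
    σ.complex ⟶ σ'.complex where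
  f n := σ.homMk σ' (cochainMapHom a b n) (h n)
  comm' i j _ := by
    ext z
    exact δ_cochainMap a b i j z

lemma CochainAction.quasiIso_map (σ : CochainAction Λ X Y) (σ' : CochainAction Λ X' Y')
    (a : X' ⟶ X) (b : Y ⟶ Y')
    (h : ∀ n r z, cochainMap a b n (σ.act n r z) = σ'.act n r (cochainMap a b n z))
    (hXY : ComputesRHom X Y) (hXY' : ComputesRHom X' Y') [QuasiIso a] [QuasiIso b] :
    QuasiIso (σ.map σ' a b h) := by
  rw [quasiIso_iff_elementwise]
  exact elementwiseQuasiIsoAt_cochainMap hXY hXY' a b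

end Action

section Commuting

variable {k : Type v} [CommRing k] {R S T : Type u} [Ring R] [Ring S] [Ring T]
  [Algebra k R] [Algebra k S] [Algebra k T]
  (f : R →ₐ[k] T) (g : S →ₐ[k] T) (h : ∀ r s, Commute (f r) (g s))

/-- The action of `R` on a complex of `T`-modules, by endomorphisms of the underlying complex of
`S`-modules. -/
def smulEndRingHom (X : CochainComplex (ModuleCat.{u} T) ℤ) : R →+* End (restrict g X) where
  toFun := smulEndComplex f g h X
  map_one' := HomologicalComplex.hom_ext _ _ fun n => ModuleCat.hom_ext <| LinearMap.ext fun m => by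
    change (f 1 • (show X.X n from m) : X.X n) = m
    rw [map_one, one_smul]
  map_mul' r s := HomologicalComplex.hom_ext _ _ fun n => ModuleCat.hom_ext <|
    LinearMap.ext fun m => by
      change (f (r * s) • (show X.X n from m) : X.X n) =
        (f r • (f s • (show X.X n from m)) : X.X n)
      rw [map_mul, mul_smul]
  map_zero' := HomologicalComplex.hom_ext _ _ fun n => ModuleCat.hom_ext <| LinearMap.ext fun m => by
    change (f 0 • (show X.X n from m) : X.X n) = (0 : X.X n)
    rw [map_zero, zero_smul]
  map_add' r s := HomologicalComplex.hom_ext _ _ fun n => ModuleCat.hom_ext <|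
    LinearMap.ext fun m => by
      change (f (r + s) • (show X.X n from m) : X.X n) =
        (f r • (show X.X n from m) + f s • (show X.X n from m) : X.X n)
      rw [map_add, add_smul]

/-- `Hom_S (X, Q)` as a complex of `R`-modules, for a complex `Q` of `T`-modules. -/
abbrev homOver (X : CochainComplex (ModuleCat.{u} S) ℤ) (Q : CochainComplex (ModuleCat.{u} T) ℤ) :
    CochainComplex (ModuleCat.{u} R) ℤ :=
  (CochainAction.ofTarget X (smulEndRingHom f g h Q)).complex

end Commuting

/-! ### The swap isomorphism -/

section Swap

open CochainComplex HomComplex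

variable {k : Type v} [CommRing k] {R S T : Type u} [Ring R] [Ring S] [Ring T]
  [Algebra k R] [Algebra k S] [Algebra k T]
  (f : R →ₐ[k] T) (g : S →ₐ[k] T) (h : ∀ r s, Commute (f r) (g s))
  {X : CochainComplex (ModuleCat.{u} R) ℤ} {Y : CochainComplex (ModuleCat.{u} S) ℤ}
  {Q : CochainComplex (ModuleCat.{u} T) ℤ}

variable {f g h} in
/-- The value of a cochain with values in `Hom_S (Y, Q)`. -/
def evalAt {n : ℤ} (z : Cochain X (homOver f g h Y Q) n) (p q : ℤ) (hq : p + n = q) (x : X.X p) :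
    Cochain Y (restrict g Q) q :=
  z.v p q hq x

section

variable {f g h} {n : ℤ} (z : Cochain X (homOver f g h Y Q) n) (p q : ℤ) (hq : p + n = q)

lemma evalAt_add (x x' : X.X p) :
    evalAt z p q hq (x + x') = evalAt z p q hq x + evalAt z p q hq x' :=
  (z.v p q hq).hom.map_add x x'

lemma evalAt_smul (r : R) (x : X.X p) :
    evalAt z p q hq (r • x) =
      cochainMap (𝟙 Y) (smulEndRingHom f g h Q r) q (evalAt z p q hq x) :=
  (z.v p q hq).hom.map_smul r x

end

variable {f g h} in
lemma evalAt_δ {n m : ℤ} (z : Cochain X (homOver f g h Y Q) n) (p q : ℤ) (hm : n + 1 = m) (hq' : p + m = q) (x : X.X p) :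
    evalAt (δ n m z) p q hq' x = δ (q - 1) q (evalAt z p (q - 1) (by lia) x) +
      m.negOnePow • evalAt z (p + 1) q (by lia) (X.d p (p + 1) x) := by
  unfold evalAt
  rw [δ_v n m hm z p q hq' (q - 1) (p + 1) rfl rfl]
  rfl

variable {f g h} in
/-- The value in `Q` of a cochain with values in `Hom_S (Y, Q)`. -/
def eval₂ {n : ℤ} (z : Cochain X (homOver f g h Y Q) n) (p i j : ℤ) (hj : p + i + n = j)
    (x : X.X p) (y : Y.X i) : Q.X j :=
  ((evalAt z p (p + n) rfl x).v i j (by lia) y : (restrict g Q).X j)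

variable {f g h} in
-- In `eval₂` the intermediate degree is literally `p + n`. Freeing it allows degrees such as `p + m
-- - 1`, which occur in the differential, to be matched.
lemma eval₂_eq {n : ℤ} (z : Cochain X (homOver f g h Y Q) n) (p i j q : ℤ) (hq : p + n = q) (hj : i + q = j) (x : X.X p) (y : Y.X i) :
    ((evalAt z p q hq x).v i j hj y : (restrict g Q).X j) = eval₂ z p i j (by lia) x y := by
  subst hq
  rfl

variable {f g h} in
lemma eval₂_ext {n : ℤ} {z z' : Cochain X (homOver f g h Y Q) n}
    (H : ∀ p i j hj x y, eval₂ z p i j hj x y = eval₂ z' p i j hj x y) : z = z' := by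
  ext p q hq : 1
  refine ModuleCat.hom_ext (LinearMap.ext fun x => ?_)
  change evalAt z p q hq x = evalAt z' p q hq x
  ext i j hj y
  exact (eval₂_eq z p i j q hq hj x y).trans
    ((H _ _ _ _ _ _).trans (eval₂_eq z' p i j q hq hj x y).symm)

section

variable {f g h} {n : ℤ} (z : Cochain X (homOver f g h Y Q) n) (p i j : ℤ) (hj : p + i + n = j)

lemma eval₂_smul_left (r : R) (x : X.X p) (y : Y.X i) :
    eval₂ z p i j hj (r • x) y = f r • eval₂ z p i j hj x y := by
  unfold eval₂
  rw [evalAt_smul, cochainMap_v]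
  rfl

lemma eval₂_smul_right (s : S) (x : X.X p) (y : Y.X i) :
    eval₂ z p i j hj x (s • y) = g s • eval₂ z p i j hj x y :=
  ((evalAt z p (p + n) rfl x).v i j (by lia)).hom.map_smul s y

lemma eval₂_add_left (x x' : X.X p) (y : Y.X i) :
    eval₂ z p i j hj (x + x') y = eval₂ z p i j hj x y + eval₂ z p i j hj x' y := by
  unfold eval₂
  rw [evalAt_add, Cochain.add_v]
  rfl

lemma eval₂_add_right (x : X.X p) (y y' : Y.X i) :
    eval₂ z p i j hj x (y + y') = eval₂ z p i j hj x y + eval₂ z p i j hj x y' :=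
  ((evalAt z p (p + n) rfl x).v i j (by lia)).hom.map_add y y'

end

variable {f g h} in
lemma eval₂_δ {n m : ℤ} (hm : n + 1 = m) (z : Cochain X (homOver f g h Y Q) n) (p i j : ℤ) (hj : p + i + m = j) (x : X.X p) (y : Y.X i) :
    eval₂ (δ n m z) p i j hj x y =
      Q.d (j - 1) j (eval₂ z p i (j - 1) (by lia) x y) +
      (p + m).negOnePow • eval₂ z p (i + 1) j (by lia) x (Y.d i (i + 1) y) +
      m.negOnePow • eval₂ z (p + 1) i j (by lia) (X.d p (p + 1) x) y := by
  rw [← eval₂_eq _ p i j (p + m) rfl (by lia), evalAt_δ z p (p + m) hm rfl, Cochain.add_v,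
    δ_v (p + m - 1) (p + m) (by lia) _ i j _ (j - 1) (i + 1) rfl rfl, Cochain.units_smul_v]
  rw [← eval₂_eq z p i (j - 1) (p + m - 1) (by lia) (by lia),
    ← eval₂_eq z p (i + 1) j (p + m - 1) (by lia) (by lia),
    ← eval₂_eq z (p + 1) i j (p + m) (by lia) (by lia)]
  rfl

/-- A cochain with values in `Hom_S (Y, Q)`, from a family of bilinear maps. -/
def mkBilinear (n : ℤ) (b : ∀ p i j : ℤ, p + i + n = j → X.X p → Y.X i → Q.X j)
    (add_left : ∀ p i j hj x x' y, b p i j hj (x + x') y = b p i j hj x y + b p i j hj x' y)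
    (add_right : ∀ p i j hj x y y', b p i j hj x (y + y') = b p i j hj x y + b p i j hj x y')
    (smul_left : ∀ p i j hj (r : R) x y, b p i j hj (r • x) y = f r • b p i j hj x y)
    (smul_right : ∀ p i j hj (s : S) x y, b p i j hj x (s • y) = g s • b p i j hj x y) :
    Cochain X (homOver f g h Y Q) n :=
  Cochain.mk fun p q hq => ModuleCat.ofHom (Y := (homOver f g h Y Q).X q)
    { toFun := fun x => (Cochain.mk fun i j hj => ModuleCat.ofHom (Y := (restrict g Q).X j)
        { toFun := fun y => (b p i j (by lia) x y : Q.X j)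
          map_add' := add_right p i j (by lia) x
          map_smul' := fun s y => smul_right p i j (by lia) s x y } : Cochain Y (restrict g Q) q)
      map_add' := fun x x' => by
        change (_ : Cochain Y (restrict g Q) q) = (_ : Cochain Y (restrict g Q) q)
        ext i j hj y
        exact add_left p i j (by lia) x x' y
      map_smul' := fun r x => by
        change (_ : Cochain Y (restrict g Q) q) = cochainMap _ _ _ (_ : Cochain Y (restrict g Q) q)
        ext i j hj y
        rw [cochainMap_v]
        exact smul_left p i j (by lia) r x y }

/-- Exchanging the two arguments of a bilinear cochain. -/
def swapCochain (h' : ∀ s r, Commute (g s) (f r)) {n : ℤ} (z : Cochain X (homOver f g h Y Q) n) :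
    Cochain Y (homOver g f h' X Q) n :=
  mkBilinear g f h' n
    (fun i p j hj y x => (p * i).negOnePow • eval₂ z p i j (by lia) x y)
    (fun i p j hj y y' x => by rw [eval₂_add_right, smul_add])
    (fun i p j hj y x x' => by rw [eval₂_add_left, smul_add])
    (fun i p j hj s y x => by rw [eval₂_smul_right, smul_comm])
    (fun i p j hj r y x => by rw [eval₂_smul_left, smul_comm])

lemma eval₂_swapCochain (h' : ∀ s r, Commute (g s) (f r)) {n : ℤ}
    (z : Cochain X (homOver f g h Y Q) n) (i p j : ℤ) (hj : i + p + n = j) (y : Y.X i) (x : X.X p) :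
    eval₂ (swapCochain f g h h' z) i p j hj y x =
      (p * i).negOnePow • eval₂ z p i j (by lia) x y := rfl

lemma swapCochain_swapCochain (h' : ∀ s r, Commute (g s) (f r)) {n : ℤ}
    (z : Cochain X (homOver f g h Y Q) n) :
    swapCochain g f h' h (swapCochain f g h h' z) = z := by
  refine eval₂_ext fun p i j hj x y => ?_
  rw [eval₂_swapCochain, eval₂_swapCochain, smul_smul, mul_comm p i, ← Int.negOnePow_add,
    Int.negOnePow_even _ ⟨_, rfl⟩, one_smul]

/-- The Koszul sign `(-1)^(p * i)` in `swapCochain` is what makes this true: it exchanges the signs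
with which the differentials of `X` and `Y` enter `eval₂_δ`. -/
lemma δ_swapCochain (h' : ∀ s r, Commute (g s) (f r)) {n m : ℤ} (hm : n + 1 = m)
    (z : Cochain X (homOver f g h Y Q) n) :
    δ n m (swapCochain f g h h' z) = swapCochain f g h h' (δ n m z) := by
  refine eval₂_ext fun i p j hj y x => ?_
  rw [eval₂_δ hm, eval₂_swapCochain, eval₂_swapCochain, eval₂_swapCochain, eval₂_swapCochain,
    eval₂_δ hm]
  have h₁ (u : ℤˣ) (q : Q.X (j - 1)) : Q.d (j - 1) j (u • q) = u • Q.d (j - 1) j q := by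
    rw [Units.smul_def, Units.smul_def, map_zsmul]
  rw [h₁, smul_add, smul_add, smul_smul, smul_smul, smul_smul, smul_smul, ← Int.negOnePow_add,
    ← Int.negOnePow_add, ← Int.negOnePow_add, ← Int.negOnePow_add]
  -- The terms containing the differentials of `X` and `Y` appear in opposite orders on the two
  -- sides. Matched crosswise, their signs have exponents that differ by `2 * i` and by `0`.
  have h₂ {a b c b' c' : Q.X j} (hb : b = c') (hc : c = b') : a + b + c = a + b' + c' := by
    rw [hb, hc, add_right_comm]
  refine h₂ ?_ ?_ <;> congr 1
  · rw [Int.negOnePow_eq_iff]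
    exact ⟨i, by ring⟩
  · rw [Int.negOnePow_eq_iff]
    exact ⟨0, by ring⟩

variable {f g h} in
lemma eval₂_add {n : ℤ} (z z' : Cochain X (homOver f g h Y Q) n) (p i j : ℤ)
    (hj : p + i + n = j) (x : X.X p) (y : Y.X i) :
    eval₂ (z + z') p i j hj x y = eval₂ z p i j hj x y + eval₂ z' p i j hj x y :=
  rfl

open scoped ModuleCat.Algebra in
-- Scalars from `k` act through `R`, but their effect on values in `Q` is that of `algebraMap k T`,
-- which no longer distinguishes `R` from `S`. This makes the swap `k`-linear.
lemma eval₂_smul {n : ℤ} (c : k) (z : Cochain X (homOver f g h Y Q) n) (p i j : ℤ)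
    (hj : p + i + n = j) (x : X.X p) (y : Y.X i) :
    eval₂ (c • z) p i j hj x y = algebraMap k T c • eval₂ z p i j hj x y := by
  rw [← f.commutes]
  change ((cochainMap (𝟙 Y) (smulEndRingHom f g h Q (algebraMap k R c)) (p + n)
    (evalAt z p (p + n) rfl x)).v i j _ y : (restrict g Q).X j) = _
  rw [cochainMap_v]
  rfl

open scoped ModuleCat.Algebra in
/-- The isomorphism `Hom_R (X, Hom_S (Y, Q)) ≅ Hom_S (Y, Hom_R (X, Q))`. -/
def swapIso (h' : ∀ s r, Commute (g s) (f r)) :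
    homComplex k X (homOver f g h Y Q) ≅ homComplex k Y (homOver g f h' X Q) :=
  HomologicalComplex.Hom.isoOfComponents (fun n => LinearEquiv.toModuleIso
    { toFun := swapCochain f g h h'
      map_add' := fun z z' => eval₂_ext fun i p j hj y x => by
        rw [eval₂_swapCochain, eval₂_add, eval₂_add, eval₂_swapCochain, eval₂_swapCochain, smul_add]
      map_smul' := fun c z => eval₂_ext fun i p j hj y x => by
        rw [eval₂_swapCochain, eval₂_smul, RingHom.id_apply, eval₂_smul, eval₂_swapCochain, smul_comm]
      invFun := swapCochain g f h' h
      left_inv := swapCochain_swapCochain f g h h'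
      right_inv := swapCochain_swapCochain g f h' h })
    (fun i j hij => by
      ext z : 2
      exact δ_swapCochain f g h h' hij z)

end Swap

/-! ### Quasi-isomorphisms from stalk complexes -/

section Stalk

open CochainComplex HomComplex

/-- The three conditions do not involve scalars. A homothety that is a quasi-isomorphism over `k` is
thereby one over whichever ring makes it linear. -/
lemma quasiIso_mkHomFromSingle_iff {R : Type v} [Ring R] {M : ModuleCat.{u} R}
    {L : CochainComplex (ModuleCat.{u} R) ℤ} (φ : M ⟶ L.X 0) (hφ) :
    QuasiIso (HomologicalComplex.mkHomFromSingle φ hφ : stalk M ⟶ L) ↔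
      (∀ y, L.d 0 (0 + 1) y = 0 → ∃ m z, φ m + L.d (0 - 1) 0 z = y) ∧
      (∀ m, (∃ z, L.d (0 - 1) 0 z = φ m) → m = 0) ∧
      ∀ n ≠ 0, ∀ y, L.d n (n + 1) y = 0 → ∃ z, L.d (n - 1) n z = y := by
  rw [quasiIso_iff_elementwise]
  have hz (n : ℤ) (hn : n ≠ 0) (x y : (stalk M).X n) : x = y := by
    have := ModuleCat.subsingleton_of_isZero
      (HomologicalComplex.isZero_single_obj_X (ComplexShape.up ℤ) 0 M n hn)
    exact Subsingleton.elim x y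
  let e : (stalk M).X 0 ≅ M := HomologicalComplex.singleObjXSelf (ComplexShape.up ℤ) 0 M
  have he (x : (stalk M).X 0) :
      (HomologicalComplex.mkHomFromSingle φ hφ : stalk M ⟶ L).f 0 x = φ (e.hom x) := by
    rw [HomologicalComplex.mkHomFromSingle_f]
    rfl
  have he' (m : M) : e.hom (e.inv m) = m := ConcreteCategory.congr_hom e.inv_hom_id m
  have he'' (x : (stalk M).X 0) : e.inv (e.hom x) = x := ConcreteCategory.congr_hom e.hom_inv_id x
  constructor
  · intro h
    refine ⟨fun y hy => ?_, fun m hm => ?_, fun n hn y hy => ?_⟩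
    · obtain ⟨x, -, z, hz⟩ := (h 0).1 y hy
      exact ⟨e.hom x, z, by rw [← he]; exact hz⟩
    · obtain ⟨w, hw⟩ := (h 0).2 (e.inv m) (hz _ (by simp) _ _) (by rw [he, he']; exact hm)
      rw [← he' m, ← hw, hz _ (by simp) w 0, map_zero, map_zero]
    · obtain ⟨x, -, z, h⟩ := (h n).1 y hy
      rw [hz n hn x 0, map_zero, zero_add] at h
      exact ⟨z, h⟩
  · rintro ⟨h₁, h₂, h₃⟩ n
    by_cases hn : n = 0
    · subst hn
      refine ⟨fun y hy => ?_, fun x _ hx => ?_⟩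
      · obtain ⟨m, z, h⟩ := h₁ y hy
        exact ⟨e.inv m, hz _ (by simp) _ _, z, by rw [he, he', h]⟩
      · rw [he] at hx
        refine ⟨0, ?_⟩
        rw [← he'' x, h₂ _ hx, map_zero, map_zero]
    · refine ⟨fun y hy => ?_, fun x _ _ => ⟨0, hz n hn _ _⟩⟩
      obtain ⟨z, h⟩ := h₃ n hn y hy
      exact ⟨0, map_zero _, z, by rw [map_zero, zero_add, h]⟩

variable {C : Type*} [Category* C] [Preadditive C] {X Y X' Y' : CochainComplex C ℤ}

/-- The map `φ` from `M` to the cocycles of degree `0` induces a quasi-isomorphism from `M` to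
`Hom (X, Y)`. -/
structure IsStalkQuasiIso {M : Type*} [Zero M] (φ : M → Cochain X Y 0) : Prop where
  δ_eq_zero (m : M) : δ 0 (0 + 1) (φ m) = 0
  exists_eq (y : Cochain X Y 0) : δ 0 (0 + 1) y = 0 → ∃ m z, φ m + δ (0 - 1) 0 z = y
  eq_zero (m : M) : (∃ z, δ (0 - 1) 0 z = φ m) → m = 0
  exact (n : ℤ) : n ≠ 0 → ∀ y : Cochain X Y n, δ n (n + 1) y = 0 → ∃ z, δ (n - 1) n z = y

end Stalk

section

open CochainComplex HomComplex

lemma IsStalkQuasiIso.cochainMap {C : Type*} [Category* C] [Abelian C]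
    {X Y X' Y' : CochainComplex C ℤ} {M : Type*} [Zero M] {φ : M → Cochain X Y 0}
    (hφ : IsStalkQuasiIso φ) (hXY : ComputesRHom X Y) (hXY' : ComputesRHom X' Y') (a : X' ⟶ X)
    (b : Y ⟶ Y') [QuasiIso a] [QuasiIso b] :
    IsStalkQuasiIso (fun m => cochainMap a b 0 (φ m)) where
  δ_eq_zero m := by
    rw [δ_cochainMap, hφ.δ_eq_zero]
    simp [ACRing.cochainMap]
  exists_eq y hy := by
    obtain ⟨x, hx, z, rfl⟩ := (elementwiseQuasiIsoAt_cochainMap hXY hXY' a b 0).1 y hy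
    obtain ⟨m, z', rfl⟩ := hφ.exists_eq x hx
    exact ⟨m, ACRing.cochainMap a b _ z' + z, by
      rw [cochainMap_add, δ_add, δ_cochainMap, add_assoc]⟩
  eq_zero m hm := hφ.eq_zero m
    ((elementwiseQuasiIsoAt_cochainMap hXY hXY' a b 0).2 _ (hφ.δ_eq_zero m) hm)
  exact n hn y hy := by
    obtain ⟨x, hx, z, rfl⟩ := (elementwiseQuasiIsoAt_cochainMap hXY hXY' a b n).1 y hy
    obtain ⟨z', rfl⟩ := hφ.exact n hn x hx
    exact ⟨ACRing.cochainMap a b _ z' + z, by rw [δ_add, δ_cochainMap]⟩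

variable {S : Type u} [Ring S] {X Y : CochainComplex (ModuleCat.{u} S) ℤ} {Λ : Type u} [Ring Λ]

/-- The morphism of complexes of modules given by a linear map to the cocycles of degree `0`. -/
def CochainAction.fromStalk (σ : CochainAction Λ X Y) {M : ModuleCat.{u} Λ}
    (φ : M →+ Cochain X Y 0) (hδ : ∀ m, δ 0 (0 + 1) (φ m) = 0)
    (hσ : ∀ r m, φ (r • m) = σ.act 0 r (φ m)) : stalk M ⟶ σ.complex :=
  HomologicalComplex.mkHomFromSingle (ModuleCat.ofHom (Y := σ.obj 0)
    { toFun := φ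
      map_add' := φ.map_add
      map_smul' := hσ }) (by
    intro j hj
    obtain rfl : 0 + 1 = j := hj
    ext m
    exact hδ m)

lemma CochainAction.quasiIso_fromStalk (σ : CochainAction Λ X Y) {M : ModuleCat.{u} Λ}
    (φ : M →+ Cochain X Y 0) (hσ) (hφ : IsStalkQuasiIso φ) :
    QuasiIso (σ.fromStalk φ hφ.δ_eq_zero hσ) := by
  refine (quasiIso_mkHomFromSingle_iff (L := σ.complex) _ _).2 ?_
  exact ⟨hφ.exists_eq, hφ.eq_zero, hφ.exact⟩

end

/-! ### Homotheties and the isomorphism of the two dual complexes -/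

section Homothety

open CochainComplex HomComplex

variable {k : Type v} [CommRing k] {R S T : Type u} [Ring R] [Ring S] [Ring T]
  [Algebra k R] [Algebra k S] [Algebra k T]
  (f : R →ₐ[k] T) (g : S →ₐ[k] T) (h : ∀ r s, Commute (f r) (g s))
  (P : CochainComplex (ModuleCat.{u} T) ℤ)

open scoped ModuleCat.Algebra in
/-- The homothety map `R → Hom_S (P, P)^0`. -/
def homothetyHom : R →+ Cochain (restrict g P) (restrict g P) 0 :=
  AddMonoidHom.mk' (fun r => Cochain.ofHom (smulEndComplex f g h P r))
    (homothetyLinear f g h P).map_add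

variable {f g h P} in
lemma isStalkQuasiIso_homothetyHom (hP : QuasiIso (homothety f g h P)) :
    IsStalkQuasiIso (homothetyHom f g h P) := by
  replace hP := (quasiIso_mkHomFromSingle_iff (L := homComplex k (restrict g P) (restrict g P))
    _ _).1 hP
  exact ⟨fun r => δ_ofHom _, hP.1, hP.2.1, hP.2.2⟩

variable {f g h P} in
/-- If `P` is K-projective over `R` and over `S`, and the homothety morphism of `R` is a
quasi-isomorphism, then `Hom_R (P, R)` is quasi-isomorphic to `Hom_R (P, Hom_S (P, P))`. -/
lemma exists_quasiIso_homComplex_regular (hP : QuasiIso (homothety f g h P))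
    [(restrict f P).IsKProjective] :
    ∃ φ : homComplex k (restrict f P) (stalk (ModuleCat.of R R)) ⟶
      homComplex k (restrict f P) (homOver f g h (restrict g P) P), QuasiIso φ := by
  have hR := isStalkQuasiIso_homothetyHom hP
  let σ := CochainAction.ofTarget (restrict g P) (smulEndRingHom f g h P)
  -- Multiplication by `r * m` is multiplication by `m` followed by multiplication by `r`, so the
  -- homothety is linear for the action of `R` on the target. It is then a quasi-isomorphism over
  -- `R`, which `Hom_R (P, -)` preserves.
  have hσ (r m : R) : homothetyHom f g h P (r • m) = σ.act 0 r (homothetyHom f g h P m) := by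
    change Cochain.ofHom (smulEndComplex f g h P (r * m)) =
      cochainMap (𝟙 _) (smulEndComplex f g h P r) 0 (Cochain.ofHom (smulEndComplex f g h P m))
    ext p x
    rw [cochainMap_v, Cochain.ofHom_v, Cochain.ofHom_v]
    exact (congrArg (· • (show P.X p from x)) (map_mul f r m)).trans (mul_smul _ _ _)
  have := σ.quasiIso_fromStalk (M := ModuleCat.of R R) (homothetyHom f g h P) hσ hR
  exact ⟨homComplexMap k (𝟙 _) (σ.fromStalk _ _ hσ), quasiIso_homComplexMap k
    (computesRHom_of_isKProjective _ _) (computesRHom_of_isKProjective _ _) _ _⟩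

variable {f g h P} in
-- The chain is `Hom_R (P, R) ≃ Hom_R (P, Hom_S (P, P)) ≅ Hom_S (P, Hom_R (P, P)) ≃ Hom_S (P, S)`,
-- with the swap in the middle and one homothety at each end.
lemma nonempty_iso_Q_homComplex_regular [HasDerivedCategory.{w} (ModuleCat.{u} k)]
    {h' : ∀ s r, Commute (g s) (f r)}
    (hR : QuasiIso (homothety f g h P)) (hS : QuasiIso (homothety g f h' P))
    [(restrict f P).IsKProjective] [(restrict g P).IsKProjective] :
    Nonempty (DerivedCategory.Q.obj (homComplex k (restrict f P) (stalk (ModuleCat.of R R))) ≅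
      DerivedCategory.Q.obj (homComplex k (restrict g P) (stalk (ModuleCat.of S S)))) := by
  obtain ⟨φ, _⟩ := exists_quasiIso_homComplex_regular hR
  obtain ⟨ψ, _⟩ := exists_quasiIso_homComplex_regular hS
  exact ⟨asIso (DerivedCategory.Q.map φ) ≪≫ DerivedCategory.Q.mapIso (swapIso f g h h') ≪≫
    (asIso (DerivedCategory.Q.map ψ)).symm⟩

end Homothety

/-! ### Lifting quasi-isomorphisms; independence of `RHom` from the resolution -/

section Lift

open CochainComplex HomComplex

attribute [local instance] HasDerivedCategory.standard in
/-- Quasi-isomorphisms can be lifted along quasi-isomorphisms, for K-projective sources. -/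
lemma exists_quasiIso_of_isKProjective {C : Type*} [Category* C] [Abelian C]
    {X Y Z : CochainComplex C ℤ} [X.IsKProjective] (a : X ⟶ Z) (b : Y ⟶ Z) [QuasiIso a]
    [QuasiIso b] : ∃ φ : X ⟶ Y, QuasiIso φ := by
  obtain ⟨u, hu⟩ := (CochainComplex.IsKProjective.Qh_map_bijective X _).2
    (DerivedCategory.Qh.map ((HomotopyCategory.quotient C _).map a) ≫
      inv (DerivedCategory.Qh.map ((HomotopyCategory.quotient C _).map b)))
  obtain ⟨φ, rfl⟩ := (HomotopyCategory.quotient C _).map_surjective u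
  refine ⟨φ, ?_⟩
  rw [← DerivedCategory.isIso_Q_map_iff_quasiIso,
    ← NatIso.isIso_map_iff (DerivedCategory.quotientCompQhIso C), Functor.comp_map, hu]
  infer_instance

attribute [local instance] HasDerivedCategory.standard in
/-- Quasi-isomorphisms can be extended along quasi-isomorphisms, for K-injective targets. -/
lemma exists_quasiIso_of_isKInjective {C : Type*} [Category* C] [Abelian C]
    {X Y Z : CochainComplex C ℤ} [Y.IsKInjective] (a : X ⟶ Z) (b : Y ⟶ Z) [QuasiIso a]
    [QuasiIso b] : ∃ φ : X ⟶ Y, QuasiIso φ := by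
  obtain ⟨u, hu⟩ := (CochainComplex.IsKInjective.Qh_map_bijective _ Y).2
    (DerivedCategory.Qh.map ((HomotopyCategory.quotient C _).map a) ≫
      inv (DerivedCategory.Qh.map ((HomotopyCategory.quotient C _).map b)))
  obtain ⟨φ, rfl⟩ := (HomotopyCategory.quotient C _).map_surjective u
  refine ⟨φ, ?_⟩
  rw [← DerivedCategory.isIso_Q_map_iff_quasiIso,
    ← NatIso.isIso_map_iff (DerivedCategory.quotientCompQhIso C), Functor.comp_map, hu]
  infer_instance

variable {k : Type v} [CommRing k] [HasDerivedCategory.{w} (ModuleCat.{u} k)]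
  {R : Type u} [Ring R] [Algebra k R]

/-- The derived `Hom` complex can be computed with any projective resolution. -/
lemma nonempty_iso_RHom {X : CochainComplex (ModuleCat.{u} R) ℤ} (P : ProjRes X)
    (Y : CochainComplex (ModuleCat.{u} R) ℤ) :
    Nonempty (RHom k X Y ≅ DerivedCategory.Q.obj (homComplex k P.P Y)) := by
  have hX : Nonempty (ProjRes X) := ⟨P⟩
  have := hX.some.kProjective
  have := hX.some.quasiIso
  have := P.kProjective
  have := P.quasiIso
  obtain ⟨φ, _⟩ := exists_quasiIso_of_isKProjective P.π hX.some.π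
  have := quasiIso_homComplexMap k (computesRHom_of_isKProjective hX.some.P Y)
    (computesRHom_of_isKProjective P.P Y) φ (𝟙 Y)
  refine ⟨eqToIso ?_ ≪≫ asIso (DerivedCategory.Q.map (homComplexMap k φ (𝟙 Y)))⟩
  unfold RHom
  rw [dif_pos hX]

lemma homologicallyBounded_Q_obj_iff (K : CochainComplex (ModuleCat.{u} k) ℤ) :
    HomologicallyBounded (DerivedCategory.Q.obj K) ↔
      ∃ a b : ℤ, ∀ n, n < a ∨ b < n → Limits.IsZero (K.homology n) := by
  unfold HomologicallyBounded
  have (n : ℤ) := ((DerivedCategory.homologyFunctorFactors (ModuleCat.{u} k) n).app K).isZero_iff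
  simp only [Functor.comp_obj, HomologicalComplex.homologyFunctor_obj] at this
  simp only [this]

lemma HomologicallyBounded.of_iso {Z Z' : DerivedCategory (ModuleCat.{u} k)} (e : Z ≅ Z')
    (hZ : HomologicallyBounded Z) : HomologicallyBounded Z' := by
  obtain ⟨a, b, h⟩ := hZ
  exact ⟨a, b, fun n hn => (h n hn).of_iso ((DerivedCategory.homologyFunctor _ n).mapIso e.symm)⟩

end Lift

/-! ### Baer extension problems for modules of homomorphisms -/

section Baer

variable {R S : Type u} [Ring R] [Ring S]

/-- Extension of linear families from an ideal, for families of homomorphisms from a projective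
module to an injective module with the ring acting on the target. -/
lemma exists_extension_of_target {X Q : Type u} [AddCommGroup X] [Module S X] [AddCommGroup Q]
    [Module R Q] [Module S Q] [SMulCommClass R S Q] [Module.Projective S X] [Module.Injective R Q]
    (J : Ideal R) (γ : J →+ (X →ₗ[S] Q)) (hγ : ∀ (r : R) (j : J) x, γ (r • j) x = r • γ j x) :
    ∃ η : X →ₗ[S] Q, ∀ (j : J) x, γ j x = (j : R) • η x := by
  have : SMulCommClass S R Q := SMulCommClass.symm _ _ _
  let γ' : X →ₗ[S] (J →ₗ[R] Q) :=
    { toFun := fun x =>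
        { toFun := fun j => γ j x
          map_add' := fun j j' => by rw [map_add, LinearMap.add_apply]
          map_smul' := fun r j => hγ r j x }
      map_add' := fun x y => by ext j; exact map_add (γ j) x y
      map_smul' := fun s x => by ext j; exact map_smul (γ j) s x }
  -- This is the restriction `Hom_R (R, Q) → Hom_R (J, Q)`, surjective because `Q` is injective over
  -- `R`. As it is `S`-linear, projectivity of `X` over `S` lifts `γ'` through it.
  let ρ : Q →ₗ[S] (J →ₗ[R] Q) :=
    { toFun := fun q =>
        { toFun := fun j => (j : R) • q
          map_add' := fun j j' => add_smul _ _ _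
          map_smul' := fun r j => mul_smul _ _ _ }
      map_add' := fun x y => by ext j; exact smul_add _ _ _
      map_smul' := fun s x => by ext j; exact smul_comm _ _ _ }
  have hρ : Function.Surjective ρ := fun φ => by
    obtain ⟨φ', h⟩ := Module.Injective.out (Q := Q) J.subtype J.subtype_injective φ
    refine ⟨φ' 1, ?_⟩
    ext j
    change (j : R) • φ' 1 = φ j
    rw [← map_smul, smul_eq_mul, mul_one, ← h]
    rfl
  obtain ⟨η, hη⟩ := Module.projective_lifting_property ρ γ' hρ
  exact ⟨η, fun j x => (LinearMap.congr_fun (LinearMap.congr_fun hη x) j).symm⟩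

/-- Extension of linear families from an ideal, for families of homomorphisms from a bimodule which
is projective over the ring to an injective module. -/
lemma exists_extension_of_source {R' : Type u} [Ring R'] (e : R' ≃+* Rᵐᵒᵖ) {P Q : Type u}
    [AddCommGroup P] [Module R P] [Module S P] [SMulCommClass R S P] [AddCommGroup Q] [Module S Q]
    [Module.Projective R P] [Module.Injective S Q] (J : Ideal R') (γ : J →+ (P →ₗ[S] Q))
    (hγ : ∀ (r : R') (j : J) p, γ (r • j) p = γ j ((e r).unop • p)) :
    ∃ η : P →ₗ[S] Q, ∀ (j : J) p, γ j p = η ((e j).unop • p) := by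
  -- The sought `η` is prescribed by `ν` on the image of the multiplication `μ`, so `ker μ ≤ ker ν`
  -- is needed. Over `R` this would be injectivity of `P ⊗_R J → P`; over `ℤ`, `μ` has a kernel, but
  -- `ν` is balanced. The section `s` expresses an element of `P` by coordinates: `κ t` is the
  -- coordinate vector of `μ t`, and `ν` is recovered from `κ` by `ε`. Hence `ν` vanishes where `μ`
  -- does.
  obtain ⟨s, hs⟩ := Module.Projective.out (R := R) (P := P)
  let μ : P ⊗[ℤ] J →ₗ[S] P := TensorProduct.AlgebraTensorModule.lift
    { toFun := fun p => AddMonoidHom.toIntLinearMap (AddMonoidHom.mk' (fun j : J => (e j).unop • p)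
        (fun j j' => by rw [Submodule.coe_add, map_add, MulOpposite.unop_add, add_smul]))
      map_add' := fun p p' => by ext j; exact smul_add _ _ _
      map_smul' := fun c p => by ext j; exact smul_comm _ _ _ }
  let ν : P ⊗[ℤ] J →ₗ[S] Q := TensorProduct.AlgebraTensorModule.lift
    { toFun := fun p => AddMonoidHom.toIntLinearMap (AddMonoidHom.mk' (fun j : J => γ j p)
        (fun j j' => by rw [map_add, LinearMap.add_apply]))
      map_add' := fun p p' => by ext j; exact map_add (γ j) _ _
      map_smul' := fun c p => by ext j; exact map_smul (γ j) _ _ }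
  have hμ (p : P) (j : J) : μ (p ⊗ₜ j) = (e j).unop • p := rfl
  have hν (p : P) (j : J) : ν (p ⊗ₜ j) = γ j p := rfl
  let c (r : R) : R' := e.symm (MulOpposite.op r)
  have hc (r : R) : (e (c r)).unop = r := by simp [c]
  have hc0 : c 0 = 0 := by simp [c]
  have hcadd (r r' : R) : c (r + r') = c r + c r' := by simp [c]
  let κ₀ (p : P) (j : J) : P →₀ J := (s p).mapRange (fun r => c r • j) (by rw [hc0, zero_smul])
  have hκ₀ (p : P) (j : J) (a : P) : κ₀ p j a = c (s p a) • j := Finsupp.mapRange_apply ..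
  let κ : P ⊗[ℤ] J →ₗ[ℤ] (P →₀ J) := TensorProduct.lift <| AddMonoidHom.toIntLinearMap
    { toFun := fun p => AddMonoidHom.toIntLinearMap (AddMonoidHom.mk' (κ₀ p) (fun j j' => by
        ext a
        rw [Finsupp.add_apply, hκ₀, hκ₀, hκ₀, smul_add]))
      map_zero' := by
        ext j a
        change (κ₀ 0 j a : R') = _
        rw [hκ₀, map_zero, Finsupp.zero_apply, hc0, zero_smul]
        rfl
      map_add' := fun p p' => by
        ext j a
        change (κ₀ (p + p') j a : R') = ((κ₀ p j + κ₀ p' j) a : J)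
        rw [Finsupp.add_apply, hκ₀, hκ₀, hκ₀, map_add, Finsupp.add_apply, hcadd, add_smul] }
  have hκ (p : P) (j : J) : κ (p ⊗ₜ j) = κ₀ p j := rfl
  have hκμ (t : P ⊗[ℤ] J) (a : P) : (e (κ t a)).unop = s (μ t) a := by
    induction t using TensorProduct.induction_on with
    | zero => simp
    | tmul p j =>
      rw [hκ, hκ₀, hμ, map_smul, Finsupp.smul_apply, Submodule.coe_smul, smul_eq_mul, map_mul,
        MulOpposite.unop_mul, hc, smul_eq_mul]
    | add t t' h h' =>
      rw [map_add, Finsupp.add_apply, Submodule.coe_add, map_add, MulOpposite.unop_add, h, h',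
        map_add, map_add, Finsupp.add_apply]
  let ε : (P →₀ J) →+ Q := Finsupp.liftAddHom fun a => AddMonoidHom.mk' (fun j : J => γ j a)
    (fun j j' => by rw [map_add, LinearMap.add_apply])
  have hεκ (t : P ⊗[ℤ] J) : ε (κ t) = ν t := by
    induction t using TensorProduct.induction_on with
    | zero => simp
    | tmul p j =>
      rw [hκ, hν]
      change (κ₀ p j).sum (fun a j => γ j a) = _
      rw [Finsupp.sum_mapRange_index (fun a => by rw [map_zero, LinearMap.zero_apply])]
      conv_rhs => rw [← hs p, Finsupp.linearCombination_apply, Finsupp.sum, map_sum]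
      refine Finset.sum_congr rfl fun a _ => ?_
      refine (hγ _ _ _).trans ?_
      rw [hc]
      rfl
    | add t t' h h' => rw [map_add, map_add, h, h', map_add]
  have hker : LinearMap.ker μ ≤ LinearMap.ker ν := fun t ht => by
    rw [LinearMap.mem_ker] at ht ⊢
    have : κ t = 0 := by
      ext a
      have := hκμ t a
      rw [ht, map_zero, Finsupp.zero_apply, MulOpposite.unop_eq_zero_iff,
        EmbeddingLike.map_eq_zero_iff] at this
      rw [this]
      rfl
    rw [← hεκ, this, map_zero]
  -- The quotient by `ker μ` embeds in `P`, and injectivity of `Q` over `S` extends the map induced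
  -- by `ν` to all of `P`.
  obtain ⟨η, hη⟩ := Module.Injective.out (Q := Q) ((LinearMap.ker μ).liftQ μ le_rfl)
    (LinearMap.ker_eq_bot.1 (Submodule.ker_liftQ_eq_bot _ _ _ le_rfl))
    ((LinearMap.ker μ).liftQ ν hker)
  exact ⟨η, fun j p => (hη (Submodule.Quotient.mk (p ⊗ₜ j))).symm⟩

end Baer

/-! ### Injectivity of the terms of `Hom` complexes -/

section InjectiveHom

open CochainComplex HomComplex

variable {S : Type u} [Ring S] {X Y : CochainComplex (ModuleCat.{u} S) ℤ} {Λ : Type u} [Ring Λ]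

/-- Baer's criterion. In the applications `η` is assembled from independent extensions, one for each
component of a cochain. -/
lemma CochainAction.injective_complex_X (σ : CochainAction Λ X Y) (n : ℤ)
    (H : ∀ (J : Ideal Λ) (γ : J →+ Cochain X Y n), (∀ (r : Λ) (j : J), γ (r • j) = σ.act n r (γ j)) →
      ∃ η : Cochain X Y n, ∀ j : J, γ j = σ.act n j η) :
    Injective (σ.complex.X n) := by
  have hB : Module.Baer Λ (σ.complex.X n) := fun J γ => by
    obtain ⟨η, hη⟩ := H J (AddMonoidHom.mk' (fun j => (γ j : Cochain X Y n)) γ.map_add) (fun r j => γ.map_smul r j)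
    refine ⟨LinearMap.toSpanSingleton Λ (σ.complex.X n) η, fun x hx => ?_⟩
    exact (LinearMap.toSpanSingleton_apply _ _ _ _).trans (hη ⟨x, hx⟩).symm
  have := hB.injective
  exact Module.injective_object_of_injective_module Λ (σ.complex.X n)

variable {k : Type v} [CommRing k] {R T : Type u} [Ring R] [Ring T]
  [Algebra k R] [Algebra k S] [Algebra k T]
  (f : R →ₐ[k] T) (g : S →ₐ[k] T) (h : ∀ r s, Commute (f r) (g s))

/-- `Hom_S (X, Q)` is degreewise injective over `R` if `X` is degreewise projective over `S` and `Q`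
is degreewise injective over `R`. -/
lemma injective_homOver_X (X : CochainComplex (ModuleCat.{u} S) ℤ)
    (Q : CochainComplex (ModuleCat.{u} T) ℤ) (hX : ∀ n, Projective (X.X n))
    (hQ : ∀ n, Injective ((restrict f Q).X n)) (n : ℤ) :
    Injective ((homOver f g h X Q).X n) := by
  refine CochainAction.injective_complex_X _ n fun J γ hγ => ?_
  have key (p q : ℤ) (hpq : p + n = q) : ∃ η : X.X p ⟶ (restrict g Q).X q, ∀ j : J,
      (γ j).v p q hpq = η ≫ smulEnd f g h (Q.X q) j := by
    let : Module R (Q.X q) := Module.compHom (Q.X q) (f : R →+* T)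
    let : Module S (Q.X q) := Module.compHom (Q.X q) (g : S →+* T)
    have : SMulCommClass R S (Q.X q) := ⟨fun r s m => by
      change f r • g s • m = g s • f r • m
      rw [← mul_smul, (h r s).eq, mul_smul]⟩
    have : Module.Projective S (X.X p) := (IsProjective.iff_projective (X.X p)).2 (hX p)
    have : Module.Injective R (Q.X q) := by
      have := hQ q
      exact Module.injective_module_of_injective_object R ((restrict f Q).X q)
    let γ' : J →+ (X.X p →ₗ[S] Q.X q) := AddMonoidHom.mk' (fun j => ((γ j).v p q hpq).hom)
      (fun j j' => by rw [map_add, Cochain.add_v]; rfl)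
    obtain ⟨η, hη⟩ := exists_extension_of_target J γ' (fun r j x => by
      change ((γ (r • j)).v p q hpq : X.X p ⟶ (restrict g Q).X q) x = _
      rw [hγ]
      change ((cochainMap (𝟙 X) (smulEndComplex f g h Q r) n _).v p q hpq) x = _
      rw [cochainMap_v]
      rfl)
    exact ⟨ModuleCat.ofHom (Y := (restrict g Q).X q) η, fun j =>
      ModuleCat.hom_ext (LinearMap.ext fun x => hη j x)⟩
  choose η hη using key
  refine ⟨Cochain.mk η, fun j => ?_⟩
  change _ = cochainMap (𝟙 X) (smulEndComplex f g h Q j) n _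
  ext p q hpq : 1
  rw [hη, cochainMap_v, HomologicalComplex.id_f, Category.id_comp, Cochain.mk_v]
  rfl

/-- The action on `Hom_S (P, Y)` of the opposite ring of a ring acting on `P`. -/
abbrev sourceAction {R' : Type u} [Ring R'] (e : R' ≃+* Rᵐᵒᵖ)
    (P : CochainComplex (ModuleCat.{u} T) ℤ) (Y : CochainComplex (ModuleCat.{u} S) ℤ) :
    CochainAction R' (restrict g P) Y :=
  CochainAction.ofSource ((RingHom.op (smulEndRingHom f g h P)).comp e.toRingHom) Y

/-- `Hom_S (P, Y)` is degreewise injective over the opposite ring of `R` if `P` is degreewise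
projective over `R` and `Y` is degreewise injective over `S`. -/
lemma injective_sourceAction_X {R' : Type u} [Ring R'] (e : R' ≃+* Rᵐᵒᵖ)
    (P : CochainComplex (ModuleCat.{u} T) ℤ) (Y : CochainComplex (ModuleCat.{u} S) ℤ)
    (hP : ∀ n, Projective ((restrict f P).X n)) (hY : ∀ n, Injective (Y.X n)) (n : ℤ) :
    Injective ((sourceAction f g h e P Y).complex.X n) := by
  refine CochainAction.injective_complex_X _ n fun J γ hγ => ?_
  have key (p q : ℤ) (hpq : p + n = q) : ∃ η : (restrict g P).X p ⟶ Y.X q, ∀ j : J,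
      (γ j).v p q hpq = smulEnd f g h (P.X p) (e j).unop ≫ η := by
    let : Module R (P.X p) := Module.compHom (P.X p) (f : R →+* T)
    let : Module S (P.X p) := Module.compHom (P.X p) (g : S →+* T)
    have : SMulCommClass R S (P.X p) := ⟨fun r s m => by
      change f r • g s • m = g s • f r • m
      rw [← mul_smul, (h r s).eq, mul_smul]⟩
    have : Module.Projective R (P.X p) :=
      (IsProjective.iff_projective ((restrict f P).X p)).2 (hP p)
    have : Module.Injective S (Y.X q) := by
      have := hY q
      exact Module.injective_module_of_injective_object S (Y.X q)
    let γ' : J →+ (P.X p →ₗ[S] Y.X q) := AddMonoidHom.mk' (fun j => ((γ j).v p q hpq).hom)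
      (fun j j' => by rw [map_add, Cochain.add_v]; rfl)
    obtain ⟨η, hη⟩ := exists_extension_of_source e J γ' (fun r j x => by
      change ((γ (r • j)).v p q hpq : (restrict g P).X p ⟶ Y.X q) x = _
      rw [hγ]
      change ((cochainMap (smulEndComplex f g h P (e r).unop) (𝟙 Y) n _).v p q hpq) x = _
      rw [cochainMap_v]
      rfl)
    exact ⟨ModuleCat.ofHom (X := (restrict g P).X p) η, fun j =>
      ModuleCat.hom_ext (LinearMap.ext fun x => hη j x)⟩
  choose η hη using key
  refine ⟨Cochain.mk η, fun j => ?_⟩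
  change _ = cochainMap (smulEndComplex f g h P (e j).unop) (𝟙 Y) n _
  ext p q hpq : 1
  rw [hη, cochainMap_v, HomologicalComplex.id_f, Category.comp_id, Cochain.mk_v]
  rfl

lemma CochainAction.isZero_complex_X (σ : CochainAction Λ X Y) (n : ℤ)
    (H : ∀ p q : ℤ, p + n = q → Limits.IsZero (X.X p) ∨ Limits.IsZero (Y.X q)) :
    Limits.IsZero (σ.complex.X n) := by
  rw [ModuleCat.isZero_iff_subsingleton]
  refine ⟨fun (z z' : Cochain X Y n) => Cochain.ext _ _ fun p q hpq => ?_⟩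
  obtain hX | hY := H p q hpq
  · exact hX.eq_of_src _ _
  · exact hY.eq_of_tgt _ _

end InjectiveHom

/-! ### Truncations that preserve projectivity or injectivity -/

section Truncation

open CochainComplex Limits

variable {C D : Type*} [Category* C] [Abelian C] [Category* D] [Abelian D]

/-- Every morphism from `K^{c-1}` to an object which vanishes on boundaries extends to `K^c`. -/
def ExtendsAlongD (K : CochainComplex D ℤ) (c : ℤ) : Prop :=
  ∀ (N : D) (φ : K.X (c - 1) ⟶ N), K.d (c - 1 - 1) (c - 1) ≫ φ = 0 →
    ∃ ψ : K.X c ⟶ N, K.d (c - 1) c ≫ ψ = φ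

/-- Every morphism from an object to the cycles of `K^{q+1}` lifts to `K^q`. -/
def LiftsAlongD (K : CochainComplex D ℤ) (q : ℤ) : Prop :=
  ∀ (N : D) (φ : N ⟶ K.X (q + 1)), φ ≫ K.d (q + 1) (q + 1 + 1) = 0 →
    ∃ ψ : N ⟶ K.X q, ψ ≫ K.d q (q + 1) = φ

/-- As `L` vanishes in degree `c - 1`, the homotopy `h` satisfies `0 = d h + h d + 1` there.
Composing with `φ` kills `h d`, so `-h φ` is an extension. -/
lemma ExtendsAlongD.of_homotopyEquiv {K L : CochainComplex D ℤ} (e : HomotopyEquiv K L) (c : ℤ)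
    (hL : IsZero (L.X (c - 1))) : ExtendsAlongD K c := fun N φ hφ => by
  have h := e.homotopyHomInvId.comm (c - 1)
  rw [HomologicalComplex.comp_f, hL.eq_of_tgt (e.hom.f (c - 1)) 0, zero_comp,
    dNext_eq _ (show (ComplexShape.up ℤ).Rel (c - 1) c by simp),
    prevD_eq _ (show (ComplexShape.up ℤ).Rel (c - 1 - 1) (c - 1) by simp)] at h
  refine ⟨-(e.homotopyHomInvId.hom c (c - 1) ≫ φ), ?_⟩
  have h' := congrArg (· ≫ φ) h
  simp only [zero_comp, Preadditive.add_comp, Category.assoc, hφ, comp_zero, add_zero,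
    HomologicalComplex.id_f, Category.id_comp] at h'
  rw [Preadditive.comp_neg, neg_eq_iff_add_eq_zero]
  exact h'.symm

lemma LiftsAlongD.of_homotopyEquiv {K L : CochainComplex D ℤ} (e : HomotopyEquiv K L) (q : ℤ)
    (hL : IsZero (L.X (q + 1))) : LiftsAlongD K q := fun N φ hφ => by
  have h := e.homotopyHomInvId.comm (q + 1)
  rw [HomologicalComplex.comp_f, hL.eq_of_tgt (e.hom.f (q + 1)) 0, zero_comp,
    dNext_eq _ (show (ComplexShape.up ℤ).Rel (q + 1) (q + 1 + 1) by simp),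
    prevD_eq _ (show (ComplexShape.up ℤ).Rel q (q + 1) by simp)] at h
  refine ⟨-(φ ≫ e.homotopyHomInvId.hom (q + 1) q), ?_⟩
  have h' := congrArg (φ ≫ ·) h
  simp only [comp_zero, Preadditive.comp_add, reassoc_of% hφ, zero_comp, zero_add,
    HomologicalComplex.id_f, Category.comp_id] at h'
  rw [Preadditive.neg_comp, neg_eq_iff_add_eq_zero, Category.assoc]
  exact h'.symm

variable (F : C ⥤ D) [F.Additive] [F.PreservesHomology]

/-- In degree `c` the truncation is the cokernel of `d`. Extending the map from `K^{c-1}` onto the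
image of `d` splits that image off `K^c`, so the cokernel is a direct summand of a projective. Here
`F` forgets one of the two actions: the truncation takes place among bimodules and only the
splitting is one-sided. -/
lemma projective_truncGE_X (K : CochainComplex C ℤ) (c : ℤ)
    (hK : ∀ n, Projective (((F.mapHomologicalComplex (.up ℤ)).obj K).X n))
    (H : ExtendsAlongD ((F.mapHomologicalComplex (.up ℤ)).obj K) c) (n : ℤ) :
    Projective (((F.mapHomologicalComplex (.up ℤ)).obj (K.truncGE c)).X n) := by
  change Projective (F.obj _)
  obtain hn | rfl | hn := lt_trichotomy n c
  · have : IsZero (F.obj ((K.truncGE c).X n)) :=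
      F.map_isZero (isZero_of_isStrictlyGE _ c n hn)
    exact Projective.of_iso this.isoZero.symm inferInstance
  · have := Functor.PreservesHomology.preservesCokernel F (K.d (n - 1) n)
    have hc := CokernelCofork.mapIsColimit _ (K.opcyclesIsCokernel (n - 1) n (by simp)) F
    let p : F.obj (K.X n) ⟶ F.obj (K.opcycles n) := F.map (K.pOpcycles n)
    have hp : F.map (K.d (n - 1) n) ≫ p = 0 := by
      rw [← F.map_comp, K.d_pOpcycles, F.map_zero]
    have : Epi p := ⟨fun _ _ h => Cofork.IsColimit.hom_ext hc h⟩
    let φ : F.obj (K.X (n - 1)) ⟶ kernel p := kernel.lift p _ hp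
    obtain ⟨ψ, hψ⟩ : ∃ ψ : F.obj (K.X n) ⟶ kernel p, F.map (K.d (n - 1) n) ≫ ψ = φ := by
      refine H _ φ ?_
      change F.map (K.d (n - 1 - 1) (n - 1)) ≫ φ = 0
      rw [← cancel_mono (kernel.ι p), Category.assoc, kernel.lift_ι, zero_comp,
        ← F.map_comp, K.d_comp_d, F.map_zero]
    obtain ⟨σ, hσ⟩ : ∃ σ : F.obj (K.opcycles n) ⟶ F.obj (K.X n),
        p ≫ σ = 𝟙 _ - ψ ≫ kernel.ι p := by
      obtain ⟨σ, hσ⟩ := CokernelCofork.IsColimit.desc' hc (𝟙 (F.obj (K.X n)) - ψ ≫ kernel.ι p) (by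
        rw [Preadditive.comp_sub, Category.comp_id, reassoc_of% hψ, kernel.lift_ι, sub_self])
      exact ⟨σ, hσ⟩
    have hσp : σ ≫ p = 𝟙 _ := by
      rw [← cancel_epi p, ← Category.assoc, hσ, Preadditive.sub_comp, Category.assoc,
        kernel.condition, comp_zero, sub_zero, Category.id_comp, Category.comp_id]
    have : Projective (F.obj (K.X n)) := hK n
    have : Projective (F.obj (K.opcycles n)) := Retract.projective ⟨σ, p, hσp⟩
    exact Projective.of_iso (F.mapIso (K.truncGEXIsoOpcycles n)).symm this
  · exact Projective.of_iso (F.mapIso (K.truncGEXIso c n hn)).symm (hK n)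

/-- Dually, the cycles in degree `q` are a direct summand of `K^q`. -/
lemma injective_truncLE_X (K : CochainComplex C ℤ) (q : ℤ)
    (hK : ∀ n, Injective (((F.mapHomologicalComplex (.up ℤ)).obj K).X n))
    (H : LiftsAlongD ((F.mapHomologicalComplex (.up ℤ)).obj K) q) (n : ℤ) :
    Injective (((F.mapHomologicalComplex (.up ℤ)).obj (K.truncLE q)).X n) := by
  change Injective (F.obj _)
  obtain hn | rfl | hn := lt_trichotomy n q
  · exact Injective.of_iso (F.mapIso (K.truncLEXIso q n hn)).symm (hK n)
  · have := Functor.PreservesHomology.preservesKernel F (K.d n (n + 1))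
    have hc := KernelFork.mapIsLimit _ (K.cyclesIsKernel n (n + 1) (by simp)) F
    let p : F.obj (K.cycles n) ⟶ F.obj (K.X n) := F.map (K.iCycles n)
    have hp : p ≫ F.map (K.d n (n + 1)) = 0 := by
      rw [← F.map_comp, K.iCycles_d, F.map_zero]
    have : Mono p := ⟨fun _ _ h => Fork.IsLimit.hom_ext hc h⟩
    let φ : cokernel p ⟶ F.obj (K.X (n + 1)) := cokernel.desc p _ hp
    obtain ⟨ψ, hψ⟩ : ∃ ψ : cokernel p ⟶ F.obj (K.X n), ψ ≫ F.map (K.d n (n + 1)) = φ := by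
      refine H _ φ ?_
      change φ ≫ F.map (K.d (n + 1) (n + 1 + 1)) = 0
      rw [← cancel_epi (cokernel.π p), ← Category.assoc, cokernel.π_desc, comp_zero,
        ← F.map_comp, K.d_comp_d, F.map_zero]
    obtain ⟨σ, hσ⟩ : ∃ σ : F.obj (K.X n) ⟶ F.obj (K.cycles n),
        σ ≫ p = 𝟙 _ - cokernel.π p ≫ ψ := by
      obtain ⟨σ, hσ⟩ := KernelFork.IsLimit.lift' hc (𝟙 (F.obj (K.X n)) - cokernel.π p ≫ ψ) (by
        rw [Preadditive.sub_comp, Category.id_comp, Category.assoc, hψ, cokernel.π_desc, sub_self])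
      exact ⟨σ, hσ⟩
    have hσp : p ≫ σ = 𝟙 _ := by
      rw [← cancel_mono p, Category.assoc, hσ, Preadditive.comp_sub, cokernel.condition_assoc,
        zero_comp, sub_zero, Category.id_comp, Category.comp_id]
    have : Injective (F.obj (K.X n)) := hK n
    have : Injective (F.obj (K.cycles n)) := Retract.injective ⟨p, σ, hσp⟩
    exact Injective.of_iso (F.mapIso (K.truncLEXIsoCycles n)).symm this
  · have : IsZero (F.obj ((K.truncLE q).X n)) :=
      F.map_isZero (isZero_of_isStrictlyLE _ q n hn)
    exact Injective.of_iso this.isoZero.symm inferInstance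

lemma exactAt_mapHomologicalComplex_iff [F.Faithful] (K : CochainComplex C ℤ) (n : ℤ) :
    ((F.mapHomologicalComplex (.up ℤ)).obj K).ExactAt n ↔ K.ExactAt n :=
  ShortComplex.exact_map_iff_of_faithful (K.sc n) F

lemma isGE_mapHomologicalComplex_iff [F.Faithful] (K : CochainComplex C ℤ) (n : ℤ) :
    CochainComplex.IsGE ((F.mapHomologicalComplex (.up ℤ)).obj K) n ↔ K.IsGE n := by
  rw [CochainComplex.isGE_iff, CochainComplex.isGE_iff]
  simp only [exactAt_mapHomologicalComplex_iff]

lemma isLE_mapHomologicalComplex_iff [F.Faithful] (K : CochainComplex C ℤ) (n : ℤ) :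
    CochainComplex.IsLE ((F.mapHomologicalComplex (.up ℤ)).obj K) n ↔ K.IsLE n := by
  rw [CochainComplex.isLE_iff, CochainComplex.isLE_iff]
  simp only [exactAt_mapHomologicalComplex_iff]

end Truncation

/-! ### Dimensions bounded by resolutions -/

section InjDim

open CochainComplex HomComplex

variable {R : Type u} [Ring R]

lemma injDim_le_of_isStrictlyLE {X J : CochainComplex (ModuleCat.{u} R) ℤ} (ι : X ⟶ J)
    [QuasiIso ι] (hJ : ∀ n, Injective (J.X n)) (a b : ℤ) [J.IsStrictlyGE a] [J.IsStrictlyLE b] :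
    injDim X ≤ ((b : ℝ) : EReal) := by
  refine (iInf_le _ (⟨J, ι, hJ, J.isKInjective_of_injective a, inferInstance⟩ : InjRes X)).trans ?_
  refine iSup₂_le fun i hi => ?_
  have : i ≤ b := by
    by_contra h
    exact hi (J.isZero_of_isStrictlyLE b i (by lia))
  exact_mod_cast this

lemma pd_le_of_isStrictlyGE {X P : CochainComplex (ModuleCat.{u} R) ℤ} (π : P ⟶ X)
    [QuasiIso π] (hP : ∀ n, Projective (P.X n)) (a b : ℤ) [P.IsStrictlyGE (-a)] [P.IsStrictlyLE b] :
    pd X ≤ ((a : ℝ) : EReal) := by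
  refine (iInf_le _ (⟨P, π, hP, P.isKProjective_of_projective b, inferInstance⟩ :
    ProjRes X)).trans ?_
  refine iSup₂_le fun i hi => ?_
  have : i ≤ a := by
    by_contra h
    exact hi (P.isZero_of_isStrictlyGE (-a) (-i) (by lia))
  exact_mod_cast this

end InjDim

/-! ### Injective dimension of a stalk from a model of `Hom` -/

section InjDimBound

open CochainComplex HomComplex

lemma IsStalkQuasiIso.comp_addEquiv {C : Type*} [Category* C] [Preadditive C]
    {X Y : CochainComplex C ℤ} {M M' : Type*} [AddZeroClass M] [AddZeroClass M']
    {φ : M → Cochain X Y 0} (hφ : IsStalkQuasiIso φ) (ε : M' ≃+ M) :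
    IsStalkQuasiIso (fun m => φ (ε m)) where
  δ_eq_zero m := hφ.δ_eq_zero (ε m)
  exists_eq y hy := by
    obtain ⟨m, z, h⟩ := hφ.exists_eq y hy
    exact ⟨ε.symm m, z, by rw [ε.apply_symm_apply, h]⟩
  eq_zero m hm := (map_eq_zero_iff ε ε.injective).1 (hφ.eq_zero _ hm)
  exact := hφ.exact

variable {S : Type u} [Ring S] {X Y X' Y' : CochainComplex (ModuleCat.{u} S) ℤ}
  {Λ : Type u} [Ring Λ]

/-- If a stalk complex is quasi-isomorphic to `Hom (X, Y)`, then its injective dimension can be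
bounded with a bounded model `Hom (X', Y')` consisting of injective modules. -/
lemma CochainAction.injDim_stalk_le (σ : CochainAction Λ X Y) (σ' : CochainAction Λ X' Y')
    {M : ModuleCat.{u} Λ} (φ : M →+ Cochain X Y 0) (hφ : IsStalkQuasiIso φ)
    (hσ : ∀ r m, φ (r • m) = σ.act 0 r (φ m)) (a : X ⟶ X') (b : Y' ⟶ Y) [QuasiIso a] [QuasiIso b]
    (hab : ∀ n r z, cochainMap a b n (σ'.act n r z) = σ.act n r (cochainMap a b n z))
    (hXY : ComputesRHom X Y) (hXY' : ComputesRHom X' Y')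
    (hσ' : ∀ n, Injective (σ'.complex.X n)) (c s t q : ℤ) [X'.IsStrictlyGE c] [X'.IsStrictlyLE s]
    [Y'.IsStrictlyGE t] [Y'.IsStrictlyLE q] :
    injDim (stalk M) ≤ (((q - c : ℤ) : ℝ) : EReal) := by
  have := σ.quasiIso_fromStalk φ hσ hφ
  have := σ'.quasiIso_map σ a b hab hXY' hXY
  -- A component in degree `n` goes from `X'^i` with `c ≤ i ≤ s` to `Y'^j` with `t ≤ j ≤ q`, so `n =
  -- j - i` lies between `t - s` and `q - c`.
  have : σ'.complex.IsStrictlyGE (t - s) := by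
    rw [isStrictlyGE_iff]
    refine fun n hn => σ'.isZero_complex_X n fun i j hij => ?_
    by_cases hi : s < i
    · exact .inl (X'.isZero_of_isStrictlyLE s i hi)
    · exact .inr (Y'.isZero_of_isStrictlyGE t j (by lia))
  have : σ'.complex.IsStrictlyLE (q - c) := by
    rw [isStrictlyLE_iff]
    refine fun n hn => σ'.isZero_complex_X n fun i j hij => ?_
    by_cases hi : i < c
    · exact .inl (X'.isZero_of_isStrictlyGE c i hi)
    · exact .inr (Y'.isZero_of_isStrictlyLE q j (by lia))
  have := σ'.complex.isKInjective_of_injective (t - s)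
  -- The stalk and the injective model both map to `Hom (X, Y)`; K-injectivity of the model turns
  -- this cospan into a map from the stalk.
  obtain ⟨ι, _⟩ := exists_quasiIso_of_isKInjective (σ.fromStalk φ hφ.δ_eq_zero hσ)
    (σ'.map σ a b hab)
  exact injDim_le_of_isStrictlyLE ι hσ' (t - s) (q - c)

variable {k : Type v} [CommRing k] {R T : Type u} [Ring R] [Ring T]
  [Algebra k R] [Algebra k S] [Algebra k T]

/-- Restriction of scalars for morphisms of complexes. -/
abbrev restrictMap (g : S →ₐ[k] T) {X Y : CochainComplex (ModuleCat.{u} T) ℤ} (φ : X ⟶ Y) :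
    restrict g X ⟶ restrict g Y :=
  ((ModuleCat.restrictScalars (g : S →+* T)).mapHomologicalComplex (ComplexShape.up ℤ)).map φ

lemma quasiIso_restrictMap (g : S →ₐ[k] T) {X Y : CochainComplex (ModuleCat.{u} T) ℤ} (φ : X ⟶ Y)
    [QuasiIso φ] : QuasiIso (restrictMap g φ) := by
  have := restrictScalars_preservesHomology (g : S →+* T)
  infer_instance

variable (f : R →ₐ[k] T) (g : S →ₐ[k] T) (h : ∀ r s, Commute (f r) (g s))

lemma restrictMap_smulEndComplex {X Y : CochainComplex (ModuleCat.{u} T) ℤ} (φ : X ⟶ Y) (r : R) :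
    restrictMap g φ ≫ smulEndComplex f g h Y r = smulEndComplex f g h X r ≫ restrictMap g φ :=
  HomologicalComplex.hom_ext _ _ fun n => ModuleCat.hom_ext <| LinearMap.ext fun m =>
    ((φ.f n).hom.map_smul (f r) (show X.X n from m)).symm

lemma cochainMap_ofHom {C : Type*} [Category* C] [Abelian C] {X Y X' Y' : CochainComplex C ℤ}
    (a : X' ⟶ X) (b : Y ⟶ Y') (z : X ⟶ Y) :
    cochainMap a b 0 (Cochain.ofHom z) = Cochain.ofHom (a ≫ z ≫ b) := by
  simp [cochainMap, Cochain.ofHom_comp]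

/-- The composition of the homothety map with a morphism `P ⟶ I`, as an additive map. -/
def homothetyTo {P I : CochainComplex (ModuleCat.{u} T) ℤ} (φ : P ⟶ I) :
    R →+ Cochain (restrict g P) (restrict g I) 0 :=
  (cochainMapHom (𝟙 _) (restrictMap g φ) 0).comp (homothetyHom f g h P)

lemma homothetyTo_eq {P I : CochainComplex (ModuleCat.{u} T) ℤ} (φ : P ⟶ I) (r : R) :
    homothetyTo f g h φ r = Cochain.ofHom (smulEndComplex f g h P r ≫ restrictMap g φ) := by
  change cochainMap (𝟙 (restrict g P)) (restrictMap g φ) 0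
    (Cochain.ofHom (smulEndComplex f g h P r)) = _
  rw [cochainMap_ofHom, Category.id_comp]

/-- Multiplication by `r` may be applied before or after `φ`. The first form suits actions on the
source of `Hom`, this one actions on the target. -/
lemma homothetyTo_eq' {P I : CochainComplex (ModuleCat.{u} T) ℤ} (φ : P ⟶ I) (r : R) :
    homothetyTo f g h φ r = Cochain.ofHom (restrictMap g φ ≫ smulEndComplex f g h I r) := by
  rw [homothetyTo_eq, restrictMap_smulEndComplex]

lemma isStalkQuasiIso_homothetyTo {P I : CochainComplex (ModuleCat.{u} T) ℤ} (φ : P ⟶ I)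
    [QuasiIso φ] (hP : QuasiIso (homothety f g h P)) [(restrict g P).IsKProjective] :
    IsStalkQuasiIso (homothetyTo f g h φ) := by
  have := quasiIso_restrictMap g φ
  exact (isStalkQuasiIso_homothetyHom hP).cochainMap (computesRHom_of_isKProjective _ _)
    (computesRHom_of_isKProjective _ _) (𝟙 _) (restrictMap g φ)

end InjDimBound

/-! ### The two bounds for the regular modules -/

section Bounds

open CochainComplex HomComplex

variable {k : Type v} [CommRing k] {R S T : Type u} [Ring R] [Ring S] [Ring T]
  [Algebra k R] [Algebra k S] [Algebra k T]
  (f : R →ₐ[k] T) (g : S →ₐ[k] T) (h : ∀ r s, Commute (f r) (g s))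
  {P I : CochainComplex (ModuleCat.{u} T) ℤ}

lemma isKProjective_restrict (hPg : ∀ n, Projective ((restrict g P).X n)) (s : ℤ)
    [P.IsStrictlyLE s] : (restrict g P).IsKProjective :=
  (restrict g P).isKProjective_of_projective s

lemma isKInjective_restrict (hIg : ∀ n, Injective ((restrict g I).X n)) (t : ℤ)
    [I.IsStrictlyGE t] : (restrict g I).IsKInjective :=
  (restrict g I).isKInjective_of_injective t

variable {f g h}

/-- Here `R ≃ Hom_S (P, P) ≃ Hom_S (P, I) ≃ Hom_S (P', I')` for the truncations `P'` and `I'`.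
Projectivity of `P'` is available only over `R`, which gives injectivity of the terms over the
opposite ring; that `Hom_S (P', I')` still computes `RHom` is due to `I'` being K-injective over
`S`. -/
lemma injDim_stalk_le_of_source (φ : P ⟶ I) [QuasiIso φ]
    (c s t q : ℤ) [P.IsStrictlyLE s] [P.IsGE c] [I.IsStrictlyGE t] [I.IsLE q]
    {R' : Type u} [Ring R'] (e : R' ≃+* Rᵐᵒᵖ) {M : ModuleCat.{u} R'}
    (ε : M ≃+ R) (hε : ∀ r m, ε (r • m) = ε m * (e r).unop)
    (hP : QuasiIso (homothety f g h P)) (hPf : ∀ n, Projective ((restrict f P).X n))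
    (hPg : ∀ n, Projective ((restrict g P).X n)) (hIg : ∀ n, Injective ((restrict g I).X n))
    (hPc : ExtendsAlongD (restrict f P) c) (hIq : LiftsAlongD (restrict g I) q) :
    injDim (stalk M) ≤ (((q - c : ℤ) : ℝ) : EReal) := by
  have := isKProjective_restrict g hPg s
  have := restrictScalars_preservesHomology (f : R →+* T)
  have := restrictScalars_preservesHomology (g : S →+* T)
  have hI' : ∀ n, Injective ((restrict g (I.truncLE q)).X n) :=
    injective_truncLE_X (ModuleCat.restrictScalars (g : S →+* T)) I q hIg hIq
  have hP' : ∀ n, Projective ((restrict f (P.truncGE c)).X n) :=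
    projective_truncGE_X (ModuleCat.restrictScalars (f : R →+* T)) P c hPf hPc
  have := isKInjective_restrict g hI' t
  have := quasiIso_restrictMap g (P.πTruncGE c)
  have := quasiIso_restrictMap g (I.ιTruncLE q)
  refine CochainAction.injDim_stalk_le (sourceAction f g h e P (restrict g I))
    (sourceAction f g h e (P.truncGE c) (restrict g (I.truncLE q)))
    ((homothetyTo f g h φ).comp ε.toAddMonoidHom)
    ((isStalkQuasiIso_homothetyTo f g h φ hP).comp_addEquiv ε) ?_
    (restrictMap g (P.πTruncGE c)) (restrictMap g (I.ιTruncLE q)) ?_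
    (computesRHom_of_isKProjective _ _) (computesRHom_of_isKInjective _ _)
    (injective_sourceAction_X f g h e _ _ hP' hI') c s t q
  · intro r m
    change homothetyTo f g h φ (ε (r • m)) =
      cochainMap (smulEndRingHom f g h P (e r).unop) (𝟙 _) 0 (homothetyTo f g h φ (ε m))
    rw [hε, homothetyTo_eq, homothetyTo_eq, cochainMap_ofHom, Category.comp_id, ← Category.assoc]
    exact congrArg (fun x => Cochain.ofHom (x ≫ restrictMap g φ))
      (map_mul (smulEndRingHom f g h P) _ _)
  · intro n r z
    change cochainMap _ _ n (cochainMap (smulEndComplex f g h (P.truncGE c) (e r).unop) (𝟙 _) n z) =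
      cochainMap (smulEndComplex f g h P (e r).unop) (𝟙 _) n (cochainMap _ _ n z)
    rw [cochainMap_cochainMap, cochainMap_cochainMap, restrictMap_smulEndComplex,
      Category.comp_id, Category.id_comp]

/-- Here `S ≃ Hom_R (P, P) ≃ Hom_R (P', I')`, with `S` acting through the target. The division of
labour is reversed: `P'` is K-projective over `R`, so that `RHom` is computed, while injectivity of
`I'` over `S` makes the terms injective. -/
lemma injDim_stalk_le_of_target (φ : P ⟶ I) [QuasiIso φ]
    (c s t q : ℤ) [P.IsStrictlyLE s] [P.IsGE c] [I.IsStrictlyGE t] [I.IsLE q]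
    {h' : ∀ s r, Commute (g s) (f r)} {N : ModuleCat.{u} S}
    (ε : N ≃+ S) (hε : ∀ s m, ε (s • m) = s * ε m)
    (hP : QuasiIso (homothety g f h' P)) (hPf : ∀ n, Projective ((restrict f P).X n))
    (hIg : ∀ n, Injective ((restrict g I).X n))
    (hPc : ExtendsAlongD (restrict f P) c) (hIq : LiftsAlongD (restrict g I) q) :
    injDim (stalk N) ≤ (((q - c : ℤ) : ℝ) : EReal) := by
  have := isKProjective_restrict f hPf s
  have := restrictScalars_preservesHomology (f : R →+* T)
  have := restrictScalars_preservesHomology (g : S →+* T)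
  have hI' : ∀ n, Injective ((restrict g (I.truncLE q)).X n) :=
    injective_truncLE_X (ModuleCat.restrictScalars (g : S →+* T)) I q hIg hIq
  have hP' : ∀ n, Projective ((restrict f (P.truncGE c)).X n) :=
    projective_truncGE_X (ModuleCat.restrictScalars (f : R →+* T)) P c hPf hPc
  have := isKProjective_restrict f hP' s
  have := quasiIso_restrictMap f (P.πTruncGE c)
  have := quasiIso_restrictMap f (I.ιTruncLE q)
  refine CochainAction.injDim_stalk_le
    (CochainAction.ofTarget (restrict f P) (smulEndRingHom g f h' I))
    (CochainAction.ofTarget (restrict f (P.truncGE c)) (smulEndRingHom g f h' (I.truncLE q)))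
    ((homothetyTo g f h' φ).comp ε.toAddMonoidHom)
    ((isStalkQuasiIso_homothetyTo g f h' φ hP).comp_addEquiv ε) ?_
    (restrictMap f (P.πTruncGE c)) (restrictMap f (I.ιTruncLE q)) ?_
    (computesRHom_of_isKProjective _ _) (computesRHom_of_isKProjective _ _)
    (injective_homOver_X g f h' _ _ hP' hI') c s t q
  · intro r m
    change homothetyTo g f h' φ (ε (r • m)) =
      cochainMap (𝟙 _) (smulEndRingHom g f h' I r) 0 (homothetyTo g f h' φ (ε m))
    rw [hε, homothetyTo_eq', homothetyTo_eq', cochainMap_ofHom, Category.id_comp, Category.assoc]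
    exact congrArg (fun x => Cochain.ofHom (restrictMap f φ ≫ x))
      (map_mul (smulEndRingHom g f h' I) _ _)
  · intro n r z
    change cochainMap _ _ n (cochainMap (𝟙 _) (smulEndComplex g f h' (I.truncLE q) r) n z) =
      cochainMap (𝟙 _) (smulEndComplex g f h' I r) n (cochainMap _ _ n z)
    rw [cochainMap_cochainMap, cochainMap_cochainMap, restrictMap_smulEndComplex,
      Category.comp_id, Category.id_comp]

end Bounds

/-! ### Triangulated subcategories defined by eventual vanishing -/

section Orthogonal

open Limits Pretriangulated

variable {C : Type*} [Category* C] [Preadditive C] [HasZeroObject C] [HasShift C ℤ]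
  [∀ n : ℤ, (shiftFunctor C n).Additive] [Pretriangulated C]

/-- The morphisms from `Z` to sufficiently high shifts of the objects `W i` vanish. -/
def EventuallyOrthogonal {ι : Sort*} (W : ι → C) (Z : C) : Prop :=
  ∃ n₀ : ℤ, ∀ n ≥ n₀, ∀ i (f : Z ⟶ (W i)⟦n⟧), f = 0

lemma eq_zero_of_shift_eq_zero {C : Type*} [Category* C] [Preadditive C] [HasShift C ℤ]
    [∀ n : ℤ, (shiftFunctor C n).Additive] {X Y : C} (f : X ⟶ Y) (a : ℤ) (h : f⟦a⟧' = 0) : f = 0 :=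
  (shiftFunctor C a).map_injective (by rw [h, Functor.map_zero])

/-- The objects which are left orthogonal to sufficiently high shifts of given objects. -/
def leftOrthogonal {ι : Sort*} (W : ι → C) : ObjectProperty C := EventuallyOrthogonal W

/-- The objects such that their high shifts are right orthogonal to a given object. -/
def rightOrthogonal (Z : C) : ObjectProperty C := fun W => EventuallyOrthogonal (fun _ : Unit => W) Z

section

variable {ι : Sort*} (W : ι → C)

instance : (leftOrthogonal W).IsClosedUnderIsomorphisms where
  of_iso e := fun ⟨n₀, h⟩ => ⟨n₀, fun n hn i f => by
    rw [← cancel_epi e.hom, h n hn i (e.hom ≫ f), comp_zero]⟩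

/-- The threshold is uniform in `i`: it is translated by a shift, and an extension takes the maximum
of two. Uniformity matters when `W` runs over all modules, where it amounts to a bound on projective
dimension. -/
instance : (leftOrthogonal W).IsTriangulated where
  exists_zero := ⟨_, isZero_zero C, 0, fun _ _ _ _ => (isZero_zero C).eq_of_src _ _⟩
  isStableUnderShiftBy a := ⟨fun Z ⟨n₀, h⟩ => ⟨n₀ + a, fun n hn i f => by
    refine eq_zero_of_shift_eq_zero f (-a) ?_
    rw [← cancel_epi ((shiftFunctorCompIsoId C a (-a) (by simp)).inv.app Z),
      ← cancel_mono ((shiftFunctorAdd' C n (-a) (n - a) (by lia)).inv.app (W i)), comp_zero,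
      zero_comp]
    exact h (n - a) (by lia) i _⟩⟩
  toIsTriangulatedClosed₂ := .mk' fun T hT ⟨n₁, h₁⟩ ⟨n₃, h₃⟩ => ⟨max n₁ n₃, fun n hn i f => by
    obtain ⟨g, rfl⟩ := T.yoneda_exact₂ hT f (h₁ n (by lia) i _)
    rw [h₃ n (by lia) i g, comp_zero]⟩

end

section

variable (Z : C)

instance : (rightOrthogonal Z).IsClosedUnderIsomorphisms where
  of_iso e := fun ⟨n₀, h⟩ => ⟨n₀, fun n hn i f => by
    rw [← cancel_mono ((shiftFunctor C n).map e.inv), h n hn i (f ≫ (shiftFunctor C n).map e.inv),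
      zero_comp]⟩

instance : (rightOrthogonal Z).IsTriangulated where
  exists_zero := ⟨_, isZero_zero C, 0, fun n _ _ _ =>
    ((shiftFunctor C n).map_isZero (isZero_zero C)).eq_of_tgt _ _⟩
  isStableUnderShiftBy a := ⟨fun W ⟨n₀, h⟩ => ⟨n₀ - a, fun n hn i f => by
    rw [← cancel_mono ((shiftFunctorAdd' C a n (a + n) rfl).inv.app W), zero_comp]
    exact h (a + n) (by lia) i _⟩⟩
  toIsTriangulatedClosed₂ := .mk' fun T hT ⟨n₁, h₁⟩ ⟨n₃, h₃⟩ => ⟨max n₁ n₃, fun n hn i f => by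
    -- Shifting a triangle by `n` multiplies its morphisms by `(-1)^n`, whence the sign.
    obtain ⟨g, rfl⟩ := Triangle.coyoneda_exact₂ _ (Triangle.shift_distinguished T hT n) f (by
      change f ≫ (n.negOnePow • T.mor₂⟦n⟧') = 0
      rw [h₃ n (by lia) i (f ≫ (n.negOnePow • T.mor₂⟦n⟧'))])
    have hg : g = 0 := h₁ n (by lia) i g
    rw [hg]
    exact zero_comp⟩

end

end Orthogonal

/-! ### Reduction from complexes to finitely generated modules -/

section Devissage

open Limits Pretriangulated DerivedCategory

variable {R : Type u} [Ring R]

lemma finite_of_exact {X Y Z : ModuleCat.{u} R} (f : X ⟶ Y) (g : Y ⟶ Z) (w : f ≫ g = 0)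
    (h : (ShortComplex.mk f g w).Exact) [IsNoetherianRing R] (hX : Module.Finite R X)
    (hZ : Module.Finite R Z) : Module.Finite R Y := by
  have h' : LinearMap.range f.hom = LinearMap.ker g.hom := h.moduleCat_range_eq_ker
  have : IsNoetherian R X := isNoetherian_of_isNoetherianRing_of_finite R X
  have : IsNoetherian R Z := isNoetherian_of_isNoetherianRing_of_finite R Z
  have := isNoetherian_of_range_eq_ker f.hom g.hom h'
  infer_instance

lemma finite_of_iso {X Y : ModuleCat.{u} R} (e : X ≅ Y) (hX : Module.Finite R X) :
    Module.Finite R Y :=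
  Module.Finite.equiv e.toLinearEquiv

lemma finite_of_isZero {X : ModuleCat.{u} R} (hX : IsZero X) : Module.Finite R X := by
  have := ModuleCat.subsingleton_of_isZero hX
  infer_instance

/-- A surjection from a finitely generated free module. -/
lemma exists_free_epi (M : ModuleCat.{u} R) [Module.Finite R M] :
    ∃ (r : ℕ) (p : ModuleCat.of R (Fin r → R) ⟶ M), Epi p := by
  obtain ⟨r, f, hf⟩ := Module.Finite.exists_fin' R M
  exact ⟨r, ModuleCat.ofHom f, (ModuleCat.epi_iff_surjective _).2 hf⟩

variable [HasDerivedCategory.{w} (ModuleCat.{u} R)]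

/-- Every epimorphism from a projective module to the homology of an object of the derived
category comes from a morphism from the stalk complex. -/
lemma exists_epi_homologyFunctor_map {F : ModuleCat.{u} R} [Projective F]
    (Z : DerivedCategory (ModuleCat.{u} R)) (b : ℤ) (p : F ⟶ (homologyFunctor _ b).obj Z) [Epi p] :
    ∃ f : (singleFunctor _ b).obj F ⟶ Z, Epi ((homologyFunctor _ b).map f) := by
  let K := Q.objPreimage Z
  let e : Q.obj K ≅ Z := Q.objObjPreimageIso Z
  let e' : (homologyFunctor _ b).obj Z ≅ K.homology b :=
    (homologyFunctor _ b).mapIso e.symm ≪≫ (homologyFunctorFactors _ b).app K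
  let s : F ⟶ K.cycles b := Projective.factorThru (p ≫ e'.hom) (K.homologyπ b)
  have hs : s ≫ K.homologyπ b = p ≫ e'.hom := Projective.factorThru_comp _ _
  let f : (HomologicalComplex.single _ (.up ℤ) b).obj F ⟶ K :=
    HomologicalComplex.mkHomFromSingle (s ≫ K.iCycles b) (fun j _ => by simp)
  have hf : HomologicalComplex.cyclesMap f b =
      (HomologicalComplex.singleObjCyclesSelfIso (.up ℤ) b F).hom ≫ s := by
    rw [← cancel_mono (K.iCycles b), HomologicalComplex.cyclesMap_i,
      HomologicalComplex.mkHomFromSingle_f, HomologicalComplex.singleObjCyclesSelfIso_hom]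
    simp only [Category.assoc]
  have : Epi (HomologicalComplex.homologyMap f b) := by
    refine epi_of_epi_fac (f := HomologicalComplex.homologyπ _ b)
      (h := (HomologicalComplex.singleObjCyclesSelfIso (.up ℤ) b F).hom ≫ p ≫ e'.hom) ?_
    rw [HomologicalComplex.homologyπ_naturality, hf, Category.assoc, hs]
  have : Epi ((homologyFunctor (ModuleCat.{u} R) b).map (Q.map f)) := by
    have := ((MorphismProperty.epimorphisms (ModuleCat.{u} R)).arrow_mk_iso_iff
      (Arrow.isoOfNatIso (homologyFunctorFactors (ModuleCat.{u} R) b) (Arrow.mk f))).2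
      ‹Epi (HomologicalComplex.homologyMap f b)›
    exact this
  have : Epi ((homologyFunctor (ModuleCat.{u} R) b).map (Q.map f ≫ e.hom)) := by
    rw [Functor.map_comp]
    infer_instance
  exact ⟨Q.map f ≫ e.hom, this⟩

/-- An object of the derived category with finitely generated bounded homology is a module up to
objects built from finitely generated free modules. -/
lemma exists_finite_module [IsNoetherianRing R] (Z : DerivedCategory (ModuleCat.{u} R)) (a : ℤ)
    (m : ℕ) [Z.IsGE a] [Z.IsLE (a + m)]
    (hZ : ∀ n, Module.Finite R ((homologyFunctor (ModuleCat.{u} R) n).obj Z)) :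
    ∃ M : ModuleCat.{u} R, Module.Finite R M ∧ ∀ (𝒯 : ObjectProperty (DerivedCategory (ModuleCat.{u} R)))
      [𝒯.IsTriangulated] [𝒯.IsClosedUnderIsomorphisms],
      (∀ r : ℕ, 𝒯 ((singleFunctor _ 0).obj (ModuleCat.of R (Fin r → R)))) →
      (𝒯 Z ↔ 𝒯 ((singleFunctor _ 0).obj M)) := by
  -- Each step maps a free module in the top degree onto the top homology and passes to the cone,
  -- whose homology occupies one degree fewer. The module `M` is fixed before `𝒯`, so one `M` serves
  -- for all the vanishing properties required of it.
  induction m generalizing Z with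
  | zero =>
    have : Z.IsLE a := by simpa using ‹Z.IsLE (a + (0 : ℕ))›
    obtain ⟨M, ⟨e⟩⟩ := exists_iso_singleFunctor_obj_of_isGE_of_isLE Z a
    refine ⟨M, finite_of_iso ((homologyFunctor _ a).mapIso e ≪≫
      (singleFunctorCompHomologyFunctorIso _ a).app M) (hZ a), fun 𝒯 _ _ _ => ?_⟩
    rw [𝒯.prop_iff_of_iso e, ← 𝒯.prop_shift_iff_of_isStableUnderShift _ a]
    exact 𝒯.prop_iff_of_iso (((singleFunctors _).shiftIso a 0 a (by simp)).app M)
  | succ m ih =>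
    have := hZ (a + (m + 1 : ℕ))
    obtain ⟨r, p, _⟩ := exists_free_epi ((homologyFunctor (ModuleCat.{u} R) (a + (m + 1 : ℕ))).obj Z)
    have : Projective (ModuleCat.of R (Fin r → R)) :=
      (IsProjective.iff_projective _).1 inferInstance
    obtain ⟨f, hf⟩ := exists_epi_homologyFunctor_map Z _ p
    obtain ⟨Z', g, h, hT⟩ := distinguished_cocone_triangle f
    set F := (singleFunctor (ModuleCat.{u} R) (a + (m + 1 : ℕ))).obj (ModuleCat.of R (Fin r → R))
    have hF (n : ℤ) (hn : n ≠ a + (m + 1 : ℕ)) : IsZero ((homologyFunctor (ModuleCat.{u} R) n).obj F) := by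
      obtain hn | hn := lt_or_gt_of_ne hn
      · exact isZero_of_isGE _ _ _ hn
      · exact isZero_of_isLE _ _ _ hn
    have hF' (n : ℤ) : Module.Finite R ((homologyFunctor (ModuleCat.{u} R) n).obj F) := by
      obtain rfl | hn := eq_or_ne n (a + (m + 1 : ℕ))
      · exact finite_of_iso ((singleFunctorCompHomologyFunctorIso _ _).app _).symm
          (inferInstanceAs (Module.Finite R (Fin r → R)))
      · exact finite_of_isZero (hF n hn)
    have hex (n : ℤ) := HomologySequence.exact₃ _ hT n (n + 1) rfl
    have hfin (n : ℤ) : Module.Finite R ((homologyFunctor (ModuleCat.{u} R) n).obj Z') :=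
      finite_of_exact _ _ _ (hex n) (hZ n) (hF' _)
    have : Z'.IsGE a := by
      rw [isGE_iff]
      exact fun n hn => (hex n).isZero_of_both_zeros ((Z.isZero_of_isGE a n hn).eq_of_src _ _)
        ((hF _ (by lia)).eq_of_tgt _ _)
    have : Z'.IsLE (a + m) := by
      rw [isLE_iff]
      intro n hn
      refine (hex n).isZero_of_both_zeros ?_ ((hF _ (by lia)).eq_of_tgt _ _)
      obtain rfl | hn' := eq_or_ne n (a + (m + 1 : ℕ))
      · exact (HomologySequence.epi_homologyMap_mor₁_iff _ hT _).1 hf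
      · exact (Z.isZero_of_isLE (a + (m + 1 : ℕ)) n (by lia)).eq_of_src _ _
    obtain ⟨M, hM, H⟩ := ih Z' hfin
    refine ⟨M, hM, fun 𝒯 _ _ h𝒯 => ?_⟩
    rw [← H 𝒯 h𝒯]
    have hF𝒯 : 𝒯 F := by
      rw [← 𝒯.prop_shift_iff_of_isStableUnderShift _ (a + (m + 1 : ℕ) : ℤ)]
      exact (𝒯.prop_iff_of_iso (((singleFunctors _).shiftIso (a + (m + 1 : ℕ) : ℤ) 0 _
        (by simp)).app _)).2 (h𝒯 r)
    exact ⟨fun hZ => 𝒯.ext_of_isTriangulatedClosed₃ _ hT hF𝒯 hZ,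
      fun hZ' => 𝒯.ext_of_isTriangulatedClosed₂ _ hT hF𝒯 hZ'⟩

end Devissage

/-! ### Vanishing of derived morphisms in terms of cochains -/

section Vanishing

open CochainComplex HomComplex DerivedCategory

attribute [local instance] HasDerivedCategory.standard

variable {C : Type*} [Category* C] [Abelian C]

lemma subsingleton_cohomologyClass_iff (X Y : CochainComplex C ℤ) (n : ℤ) :
    Subsingleton (CohomologyClass X Y n) ↔
      ∀ z : Cochain X Y n, δ n (n + 1) z = 0 → ∃ y, δ (n - 1) n y = z := by
  constructor
  · intro h z hz
    have : CohomologyClass.mk (Cocycle.mk z _ rfl hz) = 0 := Subsingleton.elim _ _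
    rwa [CohomologyClass.mk_eq_zero_iff, mem_coboundaries_iff _ (n - 1) (by simp)] at this
  · intro h
    refine subsingleton_of_forall_eq 0 fun c => ?_
    obtain ⟨z, rfl⟩ := c.mk_surjective
    rw [CohomologyClass.mk_eq_zero_iff, mem_coboundaries_iff _ (n - 1) (by simp)]
    exact h z.1 (z.δ_eq_zero _)

lemma ComputesRHom.forall_eq_zero_iff {X Y : CochainComplex C ℤ} (h : ComputesRHom X Y) (n : ℤ) :
    (∀ f : Q.obj X ⟶ (Q.obj Y)⟦n⟧, f = 0) ↔
      ∀ z : Cochain X Y n, δ n (n + 1) z = 0 → ∃ y, δ (n - 1) n y = z := by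
  rw [← subsingleton_cohomologyClass_iff, (Equiv.ofBijective _ (h n)).subsingleton_congr]
  let e : Q.obj (Y⟦n⟧) ≅ (Q.obj Y)⟦n⟧ := (Q.commShiftIso n).app Y
  let e' : (Q.obj X ⟶ Q.obj (Y⟦n⟧)) ≃ (Q.obj X ⟶ (Q.obj Y)⟦n⟧) := e.homToEquiv
  refine Iff.trans ?_ e'.symm.subsingleton_congr
  exact ⟨subsingleton_of_forall_eq 0, fun h f => Subsingleton.elim _ _⟩

end Vanishing

/-! ### Finite projective dimension from (AC) -/

section FiniteProjectiveDimension

open Limits Pretriangulated DerivedCategory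

variable {C : Type*} [Category* C] [Abelian C] [HasDerivedCategory.{w} C]

lemma leftOrthogonal_singleFunctor_of_projective {ι : Sort*} (W : ι → DerivedCategory C) (s : ℤ)
    (hW : ∀ i, (W i).IsLE s) (P : C) [Projective P] :
    leftOrthogonal W ((singleFunctor C 0).obj P) := by
  -- For `n ≥ s + 1` the object `(W i)⟦n⟧` lives in degrees at most `s - n < 0`, and a projective in
  -- degree 0 has no morphisms to it.
  refine ⟨s + 1, fun n hn i f => ?_⟩
  have : ((W i)⟦n⟧).IsLE (s - n) := TStructure.t.isLE_shift (W i) s n (s - n) (by lia)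
  obtain ⟨L, _, ⟨e⟩⟩ := ((W i)⟦n⟧).exists_iso_Q_obj_of_isLE (s - n)
  rw [← cancel_mono e.hom, zero_comp]
  exact from_singleFunctor_obj_eq_zero_of_projective (f ≫ e.hom) (s - n) (by lia)

lemma rightOrthogonal_singleFunctor_free {R : Type u} [Ring R]
    [HasDerivedCategory.{w} (ModuleCat.{u} R)] (Z : DerivedCategory (ModuleCat.{u} R))
    (hZ : rightOrthogonal Z ((singleFunctor _ 0).obj (ModuleCat.of R R))) (r : ℕ) :
    rightOrthogonal Z ((singleFunctor _ 0).obj (ModuleCat.of R (Fin r → R))) := by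
  obtain ⟨n₀, h⟩ := hZ
  refine ⟨n₀, fun n hn i f => ?_⟩
  let G : ModuleCat.{u} R ⥤ DerivedCategory (ModuleCat.{u} R) :=
    singleFunctor _ 0 ⋙ shiftFunctor _ n
  let p (j : Fin r) : ModuleCat.of R (Fin r → R) ⟶ ModuleCat.of R R :=
    ModuleCat.ofHom (LinearMap.proj j)
  let s (j : Fin r) : ModuleCat.of R R ⟶ ModuleCat.of R (Fin r → R) :=
    ModuleCat.ofHom (LinearMap.single R (fun _ => R) j)
  have hps : ∑ j, p j ≫ s j = 𝟙 (ModuleCat.of R (Fin r → R)) := by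
    ext x
    simp [p, s, ModuleCat.hom_sum]
  have hG : ∑ j, G.map (p j) ≫ G.map (s j) = 𝟙 (G.obj (ModuleCat.of R (Fin r → R))) := by
    rw [← G.map_id, ← hps, G.map_sum]
    simp only [G.map_comp]
  change Z ⟶ G.obj (ModuleCat.of R (Fin r → R)) at f
  rw [← Category.comp_id f, ← hG, Preadditive.comp_sum]
  refine Finset.sum_eq_zero fun j _ => ?_
  have : f ≫ G.map (p j) = 0 := h n hn () _
  rw [← Category.assoc, this, zero_comp]

lemma leftOrthogonal_singleFunctor_iff [HasExt.{v} C] (M N : C) :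
    leftOrthogonal (fun _ : Unit => (singleFunctor C 0).obj N) ((singleFunctor C 0).obj M) ↔
      ∃ n : ℕ, ∀ i ≥ n, Subsingleton (Abelian.Ext M N i) := by
  constructor
  · rintro ⟨n₀, h⟩
    refine ⟨n₀.toNat, fun i hi => ?_⟩
    rw [Abelian.Ext.homEquiv.subsingleton_congr]
    exact subsingleton_of_forall_eq 0 (h i (by lia) ())
  · rintro ⟨n₀, h⟩
    refine ⟨n₀, fun n hn _ f => ?_⟩
    obtain ⟨m, rfl⟩ : ∃ m : ℕ, n = m := ⟨n.toNat, by lia⟩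
    have := h m (by lia)
    have := (Abelian.Ext.homEquiv (X := M) (Y := N) (n := m)).symm.subsingleton
    exact Subsingleton.elim (α := ShiftedHom _ _ _) _ _

lemma leftOrthogonal_singleFunctor_of_hasProjectiveDimensionLT (M : C) (b : ℕ)
    [HasProjectiveDimensionLT M b] :
    leftOrthogonal (fun N : C => (singleFunctor C 0).obj N) ((singleFunctor C 0).obj M) := by
  have := HasExt.standard C
  refine ⟨b, fun n hn N f => ?_⟩
  obtain ⟨m, rfl⟩ : ∃ m : ℕ, n = m := ⟨n.toNat, by lia⟩
  have := HasProjectiveDimensionLT.subsingleton M b m (by lia) N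
  have := (Abelian.Ext.homEquiv (X := M) (Y := N) (n := m)).symm.subsingleton
  exact Subsingleton.elim (α := ShiftedHom _ _ _) _ _

/-- If the extensions in one degree vanish for a class of modules which contains a given
module and is closed under taking syzygies, then that module has finite projective dimension. -/
lemma hasProjectiveDimensionLT_of_syzygies {C : Type*} [Category* C] [Abelian C] [HasExt.{v} C]
    (𝒩 : ObjectProperty C)
    (h𝒩 : ∀ X, 𝒩 X → ∃ S : ShortComplex C, S.ShortExact ∧ Projective S.X₂ ∧ S.X₃ = X ∧ 𝒩 S.X₁)
    (b : ℕ) (X : C) (hX : 𝒩 X) (hb : ∀ N, 𝒩 N → Subsingleton (Abelian.Ext X N (b + 1))) :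
    HasProjectiveDimensionLT X (b + 1) := by
  induction b generalizing X with
  | zero =>
    obtain ⟨S, hS, _, rfl, hS₁⟩ := h𝒩 X hX
    have := hb _ hS₁
    -- Since `Ext^1` from `S.X₃` to its syzygy vanishes, the identity of `S.X₃` lifts to `S.X₂`, so
    -- `S.X₃` is a direct summand of a projective.
    obtain ⟨x, hx⟩ := Abelian.Ext.covariant_sequence_exact₃ S.X₃ hS (Abelian.Ext.mk₀ (𝟙 S.X₃))
      (zero_add 1) (Subsingleton.elim _ _)
    obtain ⟨s, rfl⟩ := Abelian.Ext.homEquiv₀.symm.surjective x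
    have hs : s ≫ S.g = 𝟙 S.X₃ := Abelian.Ext.homEquiv₀.symm.injective (by simpa using hx)
    have : Projective S.X₃ := Retract.projective ⟨s, S.g, hs⟩
    infer_instance
  | succ b ih =>
    obtain ⟨S, hS, _, rfl, hS₁⟩ := h𝒩 X hX
    refine (hS.hasProjectiveDimensionLT_X₃_iff b inferInstance).2 (ih S.X₁ hS₁ fun N hN => ?_)
    have := hb N hN
    refine subsingleton_of_forall_eq 0 fun x => ?_
    obtain ⟨y, rfl⟩ := Abelian.Ext.contravariant_sequence_exact₁ hS N x
      (show 1 + (b + 1) = b + 1 + 1 by lia) (Subsingleton.elim _ _)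
    rw [y.eq_zero_of_projective, Abelian.Ext.comp_zero]

variable {R : Type u} [Ring R] [IsNoetherianRing R]

/-- The Auslander bound of `M` applies to the class of finitely generated `N` with `Ext^i(M, N) = 0`
for `i ≫ 0`. By `hMR` this class is closed under syzygies and by `hMM` it contains `M`, so the
syzygy argument applies. -/
lemma hasProjectiveDimensionLT_of_auslanderCondition (hR : AuslanderCondition R)
    (M : ModuleCat.{u} R) (hM : Module.Finite R M)
    (hMM : ∃ n : ℕ, ∀ i ≥ n, Subsingleton (Abelian.Ext M M i))
    (hMR : ∀ r : ℕ, ∃ n : ℕ, ∀ i ≥ n, Subsingleton (Abelian.Ext M (ModuleCat.of R (Fin r → R)) i)) :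
    ∃ b : ℕ, HasProjectiveDimensionLT M b := by
  obtain ⟨b, hb⟩ := hR M hM
  refine ⟨b + 1, hasProjectiveDimensionLT_of_syzygies (fun N : ModuleCat.{u} R => Module.Finite R N ∧
    ∃ n : ℕ, ∀ i ≥ n, Subsingleton (Abelian.Ext M N i)) ?_ b M ⟨hM, hMM⟩
    fun N hN => hb N hN.1 hN.2 _ (by lia)⟩
  rintro N ⟨_, n, hn⟩
  obtain ⟨r, p, _⟩ := exists_free_epi N
  obtain ⟨m, hm⟩ := hMR r
  have hS : (ShortComplex.mk _ _ (kernel.condition p)).ShortExact :=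
    { exact := ShortComplex.exact_kernel p }
  -- `Ext^i(M, -)` of the syzygy lies between `Ext^{i-1}(M, N)` and `Ext^i` into the free module;
  -- hence the shift to `n + 1`.
  refine ⟨_, hS, (IsProjective.iff_projective _).1 inferInstance, rfl, ?_, max m (n + 1),
    fun i hi => ?_⟩
  · have : IsNoetherian R (ModuleCat.of R (Fin r → R)) :=
      isNoetherian_of_isNoetherianRing_of_finite R (Fin r → R)
    exact Module.Finite.of_injective (kernel.ι p).hom ((ModuleCat.mono_iff_injective _).1
      inferInstance)
  · obtain ⟨i, rfl⟩ : ∃ j, i = j + 1 := ⟨i - 1, by lia⟩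
    have := hm (i + 1) (by lia)
    have := hn i (by lia)
    refine subsingleton_of_forall_eq 0 fun x => ?_
    obtain ⟨y, rfl⟩ := Abelian.Ext.covariant_sequence_exact₁ M hS x (Subsingleton.elim _ _) rfl
    rw [Subsingleton.elim y 0, Abelian.Ext.zero_comp]

/-- The derived form of the finiteness of the projective dimension under the condition (AC). -/
lemma leftOrthogonal_modules_of_auslanderCondition [HasDerivedCategory.{w} (ModuleCat.{u} R)]
    (hR : AuslanderCondition R) (Z : DerivedCategory (ModuleCat.{u} R)) (a b : ℤ) [Z.IsGE a]
    [Z.IsLE b] (hZ : ∀ n, Module.Finite R ((homologyFunctor (ModuleCat.{u} R) n).obj Z))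
    (hZZ : leftOrthogonal (fun _ : Unit => Z) Z)
    (hZR : leftOrthogonal (fun _ : Unit => (singleFunctor _ 0).obj (ModuleCat.of R R)) Z) :
    leftOrthogonal (fun N : ModuleCat.{u} R => (singleFunctor _ 0).obj N) Z := by
  have : Z.IsLE (a + (b - a).toNat) := TStructure.t.isLE_of_le Z b _ (by lia)
  obtain ⟨M, hM, H⟩ := exists_finite_module Z a (b - a).toNat hZ
  have hproj (r : ℕ) : Projective (ModuleCat.of R (Fin r → R)) :=
    (IsProjective.iff_projective _).1 inferInstance
  have hMZ : leftOrthogonal (fun _ : Unit => Z) ((singleFunctor _ 0).obj M) :=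
    (H _ fun r => leftOrthogonal_singleFunctor_of_projective _ b (fun _ => inferInstance) _).1 hZZ
  have hMR : leftOrthogonal (fun _ : Unit => (singleFunctor _ 0).obj (ModuleCat.of R R))
      ((singleFunctor _ 0).obj M) :=
    (H _ fun r => leftOrthogonal_singleFunctor_of_projective _ 0 (fun _ => inferInstance) _).1 hZR
  have hMF := rightOrthogonal_singleFunctor_free _ hMR
  -- With the source already replaced by `M`, the target `Z` is replaced too. This needs the free
  -- modules to be right orthogonal to `M`, which is where the vanishing of extensions by the ring
  -- enters.
  have hMM : rightOrthogonal ((singleFunctor _ 0).obj M) ((singleFunctor _ 0).obj M) :=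
    (H (rightOrthogonal _) hMF).1 hMZ
  obtain ⟨c, _⟩ := hasProjectiveDimensionLT_of_auslanderCondition hR M hM
    ((leftOrthogonal_singleFunctor_iff _ _).1 hMM)
    (fun r => (leftOrthogonal_singleFunctor_iff _ _).1 (hMF r))
  exact (H _ fun r => leftOrthogonal_singleFunctor_of_projective _ 0 (fun _ => inferInstance) _).2
    (leftOrthogonal_singleFunctor_of_hasProjectiveDimensionLT M c)

end FiniteProjectiveDimension

/-! ### Dimensions and the splitting conditions on resolutions -/

section Dimension

open CochainComplex HomComplex

variable {C : Type*} [Category* C] [Abelian C]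

lemma isGE_of_quasiIso {X Y : CochainComplex C ℤ} (φ : X ⟶ Y) [QuasiIso φ] (n : ℤ) :
    X.IsGE n ↔ Y.IsGE n := by
  simp only [isGE_iff, exactAt_iff_of_quasiIsoAt φ]

lemma isLE_of_quasiIso {X Y : CochainComplex C ℤ} (φ : X ⟶ Y) [QuasiIso φ] (n : ℤ) :
    X.IsLE n ↔ Y.IsLE n := by
  simp only [isLE_iff, exactAt_iff_of_quasiIsoAt φ]

/-- A map `P^{c-1} → N` vanishing on boundaries is a cocycle of degree `1 - c` with values in the
stalk of `N`. Writing it as a coboundary gives, up to the sign `(-1)^(1-c)`, an extension to `P^c`.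
-/
lemma extendsAlongD_of_forall_exists {P : CochainComplex C ℤ} (c : ℤ)
    (H : ∀ (N : C) (z : Cochain P ((CochainComplex.singleFunctor C 0).obj N) (1 - c)),
      δ (1 - c) (1 - c + 1) z = 0 → ∃ y, δ (1 - c - 1) (1 - c) y = z) :
    ExtendsAlongD P c := fun N φ hφ => by
  obtain ⟨y, hy⟩ := H N (Cochain.toSingleMk φ (by lia)) (by
    rw [Cochain.δ_toSingleMk φ (by lia) _ (c - 1 - 1) (by lia), hφ, Cochain.toSingleMk_zero,
      smul_zero])
  obtain ⟨ψ, rfl⟩ := Cochain.toSingleMk_surjective y c (by lia)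
  rw [Cochain.δ_toSingleMk ψ (by lia) _ (c - 1) (by lia)] at hy
  have := congrArg (Cochain.toSingleEquiv (by lia : c - 1 + (1 - c) = 0)) hy
  rw [Cochain.toSingleEquiv_toSingleMk] at this
  refine ⟨(1 - c).negOnePow • ψ, ?_⟩
  rw [← this, Units.smul_def, Units.smul_def, map_zsmul, Cochain.toSingleEquiv_toSingleMk,
    Preadditive.comp_zsmul]

attribute [local instance] HasDerivedCategory.standard in
/-- Quasi-isomorphisms to K-injective complexes extend along quasi-isomorphisms. -/
lemma exists_quasiIso_of_isKInjective_of_span {X Y Z : CochainComplex C ℤ} [Y.IsKInjective]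
    (a : Z ⟶ X) (b : Z ⟶ Y) [QuasiIso a] [QuasiIso b] : ∃ φ : X ⟶ Y, QuasiIso φ := by
  obtain ⟨u, hu⟩ := (CochainComplex.IsKInjective.Qh_map_bijective _ Y).2
    (inv (DerivedCategory.Qh.map ((HomotopyCategory.quotient C _).map a)) ≫
      DerivedCategory.Qh.map ((HomotopyCategory.quotient C _).map b))
  obtain ⟨φ, rfl⟩ := (HomotopyCategory.quotient C _).map_surjective u
  refine ⟨φ, ?_⟩
  rw [← DerivedCategory.isIso_Q_map_iff_quasiIso,
    ← NatIso.isIso_map_iff (DerivedCategory.quotientCompQhIso C), Functor.comp_map, hu]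
  infer_instance

variable {R : Type u} [Ring R] {X P : CochainComplex (ModuleCat.{u} R) ℤ}

/-- Two K-projective resolutions are homotopy equivalent. The length of an arbitrary one-sided
resolution `L` can thus be detected on the given complex `P`, which in the application carries a
bimodule structure. -/
lemma ProjRes.isGE_and_extendsAlongD (L : ProjRes X) (π : P ⟶ X) [QuasiIso π] [P.IsKProjective]
    (p : ℤ) (hL : ∀ i > p, Limits.IsZero (L.P.X (-i))) :
    P.IsGE (-p) ∧ ExtendsAlongD P (-p) := by
  have := L.quasiIso
  have := L.kProjective
  obtain ⟨φ, _⟩ := exists_quasiIso_of_isKProjective π L.π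
  have : L.P.IsStrictlyGE (-p) := (isStrictlyGE_iff _ _).2 fun i hi => by
    simpa using hL (-i) (by lia)
  obtain ⟨e, -⟩ := (IsKProjective.quasiIso_iff φ).1 inferInstance
  exact ⟨(isGE_of_quasiIso φ _).2 inferInstance, .of_homotopyEquiv e _
    (L.P.isZero_of_isStrictlyGE (-p) _ (by lia))⟩

lemma InjRes.isLE_and_liftsAlongD {I : CochainComplex (ModuleCat.{u} R) ℤ} (J : InjRes X)
    (ι : X ⟶ I) [QuasiIso ι] [I.IsKInjective]
    (q : ℤ) (hJ : ∀ i > q, Limits.IsZero (J.I.X i)) :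
    I.IsLE q ∧ LiftsAlongD I q := by
  have := J.quasiIso
  have := J.kInjective
  obtain ⟨φ, _⟩ := exists_quasiIso_of_isKInjective_of_span ι J.ι
  have : J.I.IsStrictlyLE q := (isStrictlyLE_iff _ _).2 fun i hi => hJ i hi
  obtain ⟨e, -⟩ := (IsKInjective.quasiIso_iff φ).1 inferInstance
  exact ⟨(isLE_of_quasiIso φ _).2 inferInstance, .of_homotopyEquiv e _
    (J.I.isZero_of_isStrictlyLE q _ (by lia))⟩

lemma pd_le_of_extendsAlongD (π : P ⟶ X) [QuasiIso π] (hP : ∀ n, Projective (P.X n)) (s c : ℤ)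
    [P.IsStrictlyLE s] [P.IsGE c] (h : ExtendsAlongD P c) :
    pd X ≤ (((-c : ℤ) : ℝ) : EReal) := by
  have hP' (n : ℤ) : Projective ((P.truncGE c).X n) := by
    have hP₁ : ∀ n, Projective ((((𝟭 _ : ModuleCat.{u} R ⥤ _).mapHomologicalComplex (.up ℤ)).obj
      P).X n) := hP
    exact projective_truncGE_X (𝟭 _) P c hP₁ h n
  have := P.isKProjective_of_projective s
  have := (P.truncGE c).isKProjective_of_projective s
  -- The canonical map goes from `P` to its truncation; K-projectivity of the truncation provides a
  -- quasi-isomorphism in the other direction.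
  obtain ⟨φ, _⟩ := exists_quasiIso_of_isKProjective (𝟙 (P.truncGE c)) (P.πTruncGE c)
  have : (P.truncGE c).IsStrictlyGE (- -c) := by rw [neg_neg]; infer_instance
  exact pd_le_of_isStrictlyGE (φ ≫ π) hP' (-c) s

/-- A bound by sums of lengths of resolutions is a bound by the sum of the dimensions. -/
lemma le_pd_add_injDim {S : Type u} [Ring S] {Y : CochainComplex (ModuleCat.{u} S) ℤ} {x : EReal}
    (hX : pd X < ⊤) (hY : injDim Y < ⊤)
    (H : ∀ p q : ℤ, (∃ L : ProjRes X, ∀ i > p, Limits.IsZero (L.P.X (-i))) →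
      (∃ J : InjRes Y, ∀ i > q, Limits.IsZero (J.I.X i)) → x ≤ (((q + p : ℤ) : ℝ) : EReal)) :
    x ≤ pd X + injDim Y := by
  -- Approaching both dimensions from above also covers the value `-∞`. An upper bound `a` for
  -- degrees may be replaced by `⌊a⌋`, as degrees are integers.
  refine EReal.le_add_of_forall_gt (.inr hY.ne) (.inl hX.ne) fun a ha b hb => ?_
  induction a with
  | bot => exact absurd ha not_lt_bot
  | top =>
    rw [EReal.top_add_of_ne_bot (ne_bot_of_gt hb)]
    exact le_top
  | coe a =>
    induction b with
    | bot => exact absurd hb not_lt_bot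
    | top =>
      rw [EReal.coe_add_top]
      exact le_top
    | coe b =>
      obtain ⟨L, hL⟩ := iInf_lt_iff.1 ha
      obtain ⟨J, hJ⟩ := iInf_lt_iff.1 hb
      have h₁ : ∀ i > ⌊a⌋, Limits.IsZero (L.P.X (-i)) := fun i hi => by
        by_contra h
        have := (le_iSup₂ (f := fun (i : ℤ) (_ : ¬ Limits.IsZero (L.P.X (-i))) =>
          ((i : ℝ) : EReal)) i h).trans hL.le
        exact hi.not_ge (Int.le_floor.2 (EReal.coe_le_coe_iff.1 this))
      have h₂ : ∀ i > ⌊b⌋, Limits.IsZero (J.I.X i) := fun i hi => by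
        by_contra h
        have := (le_iSup₂ (f := fun (i : ℤ) (_ : ¬ Limits.IsZero (J.I.X i)) =>
          ((i : ℝ) : EReal)) i h).trans hJ.le
        exact hi.not_ge (Int.le_floor.2 (EReal.coe_le_coe_iff.1 this))
      refine (H _ _ ⟨L, h₁⟩ ⟨J, h₂⟩).trans ?_
      rw [← EReal.coe_add, EReal.coe_le_coe_iff, Int.cast_add, add_comm a b]
      exact add_le_add (Int.floor_le b) (Int.floor_le a)

end Dimension

/-! ### Boundedness of `RHom` and finiteness of projective dimension -/

section Bounded

open CochainComplex HomComplex DerivedCategory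

variable {k : Type v} [CommRing k] {R : Type u} [Ring R] [Algebra k R]

lemma isZero_homology_homComplex_iff (X Y : CochainComplex (ModuleCat.{u} R) ℤ) (n : ℤ) :
    Limits.IsZero ((homComplex k X Y).homology n) ↔
      ∀ z : Cochain X Y n, δ n (n + 1) z = 0 → ∃ y, δ (n - 1) n y = z :=
  isZero_homology_iff _ _

/-- `RHom (X, Y)` is homologically bounded if `X` is, and `Y` has finite injective dimension. -/
lemma homologicallyBounded_RHom_of_injDim_lt_top [HasDerivedCategory.{w} (ModuleCat.{u} k)]
    {X P Y : CochainComplex (ModuleCat.{u} R) ℤ} (π : P ⟶ X) [QuasiIso π]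
    (hP : ∀ n, Projective (P.X n)) (a s t : ℤ) [P.IsStrictlyLE s] [X.IsGE a] [Y.IsStrictlyGE t]
    (hY : injDim Y < ⊤) : HomologicallyBounded (RHom k X Y) := by
  obtain ⟨e⟩ := nonempty_iso_RHom (k := k) (ProjRes.ofBounded π hP s inferInstance inferInstance) Y
  refine HomologicallyBounded.of_iso e.symm ((homologicallyBounded_Q_obj_iff _).2 ?_)
  change ∃ a b : ℤ, ∀ n, n < a ∨ b < n → Limits.IsZero ((homComplex k P Y).homology n)
  obtain ⟨J, hJ⟩ := iInf_lt_iff.1 hY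
  obtain ⟨r, hr, -⟩ := EReal.lt_iff_exists_real_btwn.1 hJ
  have hq : ∀ i > ⌊r⌋, Limits.IsZero (J.I.X i) := fun i hi => by
    by_contra h
    have := (le_iSup₂ (f := fun (i : ℤ) (_ : ¬ Limits.IsZero (J.I.X i)) =>
      ((i : ℝ) : EReal)) i h).trans hr.le
    exact hi.not_ge (Int.le_floor.2 (EReal.coe_le_coe_iff.1 this))
  -- Below, `Hom (P, Y)` itself vanishes. Above, it is compared through `Hom (P, I)` with `Hom (τ≥a
  -- P, I)`; the truncation need not be projective, but `I` is K-injective.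
  refine ⟨t - s, ⌊r⌋ - a, fun n hn => ?_⟩
  obtain hn | hn := hn
  · rw [isZero_homology_homComplex_iff]
    refine fun z _ => ⟨0, ?_⟩
    rw [δ_zero]
    refine Cochain.ext _ _ fun p q hpq => ?_
    by_cases hp : s < p
    · exact (P.isZero_of_isStrictlyLE s p hp).eq_of_src _ _
    · exact (Y.isZero_of_isStrictlyGE t q (by lia)).eq_of_tgt _ _
  · have := P.isKProjective_of_projective s
    have := J.kInjective
    have := J.quasiIso
    have : P.IsGE a := (isGE_of_quasiIso π a).2 inferInstance
    have h₁ := quasiIso_homComplexMap k (computesRHom_of_isKProjective P Y)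
      (computesRHom_of_isKProjective P J.I) (𝟙 P) J.ι
    have h₂ := quasiIso_homComplexMap k (computesRHom_of_isKInjective (P.truncGE a) J.I)
      (computesRHom_of_isKProjective P J.I) (P.πTruncGE a) (𝟙 J.I)
    rw [← HomologicalComplex.exactAt_iff_isZero_homology,
      exactAt_iff_of_quasiIsoAt (homComplexMap k (𝟙 P) J.ι),
      ← exactAt_iff_of_quasiIsoAt (homComplexMap k (P.πTruncGE a) (𝟙 J.I)),
      HomologicalComplex.exactAt_iff_isZero_homology, isZero_homology_homComplex_iff]
    refine fun z _ => ⟨0, ?_⟩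
    rw [δ_zero]
    refine Cochain.ext _ _ fun p q hpq => ?_
    by_cases hp : p < a
    · exact ((P.truncGE a).isZero_of_isStrictlyGE a p hp).eq_of_src _ _
    · exact (hq q (by lia)).eq_of_tgt _ _

attribute [local instance] HasDerivedCategory.standard in
/-- Under the condition (AC), a complex with finitely generated bounded homology has finite
projective dimension if it has no high self-extensions and no high extensions by the ring. -/
lemma exists_extendsAlongD_of_auslanderCondition [IsNoetherianRing R] (hR : AuslanderCondition R)
    (P : CochainComplex (ModuleCat.{u} R) ℤ) [P.IsKProjective] (a b : ℤ) [P.IsGE a] [P.IsLE b]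
    (hP : ∀ n, Module.Finite R (P.homology n))
    (hPP : ∃ m : ℤ, ∀ n ≥ m, ∀ z : Cochain P P n, δ n (n + 1) z = 0 → ∃ y, δ (n - 1) n y = z)
    (hPR : ∃ m : ℤ, ∀ n ≥ m, ∀ z : Cochain P (stalk (ModuleCat.of R R)) n, δ n (n + 1) z = 0 →
      ∃ y, δ (n - 1) n y = z) :
    ∃ c : ℤ, P.IsGE c ∧ ExtendsAlongD P c := by
  have hfin (n : ℤ) : Module.Finite R ((homologyFunctor (ModuleCat.{u} R) n).obj (Q.obj P)) :=
    finite_of_iso ((homologyFunctorFactors _ n).app P).symm (hP n)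
  have hZ (Y : CochainComplex (ModuleCat.{u} R) ℤ) (h : ∃ m : ℤ, ∀ n ≥ m, ∀ z : Cochain P Y n,
      δ n (n + 1) z = 0 → ∃ y, δ (n - 1) n y = z) :
      leftOrthogonal (fun _ : Unit => Q.obj Y) (Q.obj P) := by
    obtain ⟨m, hm⟩ := h
    exact ⟨m, fun n hn _ =>
      ((computesRHom_of_isKProjective P Y).forall_eq_zero_iff n).2 (hm n hn)⟩
  obtain ⟨m, hm⟩ := leftOrthogonal_modules_of_auslanderCondition hR (Q.obj P) a b hfin
    (hZ _ hPP) (hZ _ hPR)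
  -- With this `c`, `P` has no homology below `c` and `1 - c ≥ m`, so extensions of degree `1 - c`
  -- by every module vanish.
  refine ⟨min a (1 - m), P.isGE_of_ge _ a (min_le_left _ _), extendsAlongD_of_forall_exists _
    fun N => ?_⟩
  exact ((computesRHom_of_isKProjective P _).forall_eq_zero_iff _).1 (hm _ (by lia) N)

end Bounded

/-! ### The bounds for two commuting actions -/

section Bimodules

open CochainComplex HomComplex DerivedCategory

variable {k : Type v} [CommRing k]

lemma nonempty_iso_RHom_stalk [HasDerivedCategory.{w} (ModuleCat.{u} k)] {R : Type u} [Ring R]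
    [Algebra k R] {X : CochainComplex (ModuleCat.{u} R) ℤ} (P : ProjRes X) {M M' : ModuleCat.{u} R}
    (i : M ≅ M') :
    Nonempty (RHom k X (stalk M) ≅ Q.obj (homComplex k P.P (stalk M'))) := by
  obtain ⟨e⟩ := nonempty_iso_RHom (k := k) P (stalk M)
  have := P.kProjective
  let φ : stalk M ⟶ stalk M' := (HomologicalComplex.single _ (.up ℤ) 0).map i.hom
  have := quasiIso_homComplexMap k (computesRHom_of_isKProjective P.P (stalk M))
    (computesRHom_of_isKProjective P.P (stalk M')) (𝟙 P.P) φ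
  exact ⟨e ≪≫ asIso (Q.map (homComplexMap k (𝟙 P.P) φ))⟩

variable {R S T : Type u} [Ring R] [Ring S] [Ring T] [Algebra k R] [Algebra k S] [Algebra k T]
  (f : R →ₐ[k] T) (g : S →ₐ[k] T) {h : ∀ r s, Commute (f r) (g s)}
  {h' : ∀ s r, Commute (g s) (f r)} {P D I : CochainComplex (ModuleCat.{u} T) ℤ}

/-- The bounds for the injective dimensions, for commuting actions of two rings. -/
theorem injDim_le_of_auslanderCondition (π : P ⟶ D) (ι : D ⟶ I) [QuasiIso π] [QuasiIso ι]
    [HasDerivedCategory.{w} (ModuleCat.{u} k)]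
    [IsNoetherianRing R] (hR : AuslanderCondition R) (s t u a b : ℤ) [P.IsStrictlyLE s]
    [I.IsStrictlyGE t] [I.IsStrictlyLE u] [D.IsGE a] [D.IsLE b]
    (hD : ∀ n, Module.Finite R ((restrict f D).homology n))
    (hPf : ∀ n, Projective ((restrict f P).X n)) (hPg : ∀ n, Projective ((restrict g P).X n))
    (hIg : ∀ n, Injective ((restrict g I).X n))
    (hPR : QuasiIso (homothety f g h P)) (hPS : QuasiIso (homothety g f h' P))
    {M₀ : ModuleCat.{u} R} (i : M₀ ≅ ModuleCat.of R R)
    (hb : HomologicallyBounded (RHom k (restrict f D) (stalk M₀)))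
    {R' : Type u} [Ring R'] (e : R' ≃+* Rᵐᵒᵖ) {M : ModuleCat.{u} R'}
    (ε : M ≃+ R) (hε : ∀ r m, ε (r • m) = ε m * (e r).unop)
    {N : ModuleCat.{u} S} (ε' : N ≃+ S) (hε' : ∀ s m, ε' (s • m) = s * ε' m) :
    injDim (stalk M) ≤ pd (restrict f D) + injDim (restrict g D) ∧
      injDim (stalk N) ≤ pd (restrict f D) + injDim (restrict g D) ∧
      pd (restrict f D) + injDim (restrict g D) < ⊤ := by
  have := isKProjective_restrict f hPf s
  have := isKInjective_restrict g hIg t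
  have := quasiIso_restrictMap f π
  have := quasiIso_restrictMap g ι
  have := restrictScalars_preservesHomology (f : R →+* T)
  have := restrictScalars_preservesHomology (g : S →+* T)
  have : P.IsGE a := (isGE_of_quasiIso π a).2 inferInstance
  have : P.IsLE b := (isLE_of_quasiIso π b).2 inferInstance
  have : (restrict f P).IsGE a := (isGE_mapHomologicalComplex_iff _ P a).2 inferInstance
  have : (restrict f P).IsLE b := (isLE_mapHomologicalComplex_iff _ P b).2 inferInstance
  have hpd : pd (restrict f D) < ⊤ := by
    have hfin (n : ℤ) : Module.Finite R ((restrict f P).homology n) :=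
      finite_of_iso (asIso (HomologicalComplex.homologyMap (restrictMap f π) n)).symm (hD n)
    have hSS := isStalkQuasiIso_homothetyHom hPS
    let L : ProjRes (restrict f D) :=
      ProjRes.ofBounded (restrictMap f π) hPf s inferInstance inferInstance
    obtain ⟨e⟩ := nonempty_iso_RHom_stalk (k := k) L i
    obtain ⟨_, m, hm⟩ := (homologicallyBounded_Q_obj_iff _).1 (hb.of_iso e)
    -- Self-extensions over `R` vanish from degree 1 on, since the homothety identifies `Hom_R (P,
    -- P)` with `S` in degree 0; extensions by `R` vanish from `m + 1` on by boundedness.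
    obtain ⟨c, _, hc⟩ := exists_extendsAlongD_of_auslanderCondition hR (restrict f P) a b hfin
      ⟨1, fun n hn => hSS.exact n (by lia)⟩
      ⟨m + 1, fun n hn => (isZero_homology_homComplex_iff _ _ n).1 (hm n (.inr (by lia)))⟩
    exact (pd_le_of_extendsAlongD (restrictMap f π) hPf s c hc).trans_lt (EReal.coe_lt_top _)
  have hid : injDim (restrict g D) < ⊤ :=
    (injDim_le_of_isStrictlyLE (restrictMap g ι) hIg t u).trans_lt (EReal.coe_lt_top _)
  -- It suffices to bound `x` at each pair of admissible truncation degrees; resolutions of lengths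
  -- `p` and `q` provide the pair `-p`, `q`.
  have key (x : EReal) (hx : ∀ c q : ℤ, P.IsGE c → I.IsLE q → ExtendsAlongD (restrict f P) c →
      LiftsAlongD (restrict g I) q → x ≤ (((q - c : ℤ) : ℝ) : EReal)) :
      x ≤ pd (restrict f D) + injDim (restrict g D) := by
    refine le_pd_add_injDim hpd hid fun p q ⟨L, hL⟩ ⟨J, hJ⟩ => ?_
    obtain ⟨h₁, h₂⟩ := L.isGE_and_extendsAlongD (restrictMap f π) p hL
    obtain ⟨h₃, h₄⟩ := J.isLE_and_liftsAlongD (restrictMap g ι) q hJ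
    have := hx (-p) q ((isGE_mapHomologicalComplex_iff _ P _).1 h₁)
      ((isLE_mapHomologicalComplex_iff _ I _).1 h₃) h₂ h₄
    rwa [sub_neg_eq_add] at this
  refine ⟨key _ fun c q _ _ hc hq => ?_, key _ fun c q _ _ hc hq => ?_,
    EReal.add_lt_top hpd.ne hid.ne⟩
  · exact injDim_stalk_le_of_source (π ≫ ι) c s t q e ε hε hPR hPf hPg hIg hc hq
  · exact injDim_stalk_le_of_target (π ≫ ι) c s t q ε' hε' hPS hPf hIg hc hq

end Bimodules

/-! ### Dualizing complexes -/

section DualizingComplexes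

open CochainComplex DerivedCategory

variable {k : Type v} [CommRing k] [HasDerivedCategory.{w} (ModuleCat.{u} k)] {A B : Type u}
  [Ring A] [Ring B] [Algebra k A] [Algebra k B]

/-- The right regular module, as a left module over the opposite ring. -/
def rightRegularIso (B : Type u) [Ring B] : ModuleCat.of Bᵐᵒᵖ B ≅ ModuleCat.of Bᵐᵒᵖ Bᵐᵒᵖ :=
  LinearEquiv.toModuleIso (X₁ := B) (X₂ := Bᵐᵒᵖ)
    { MulOpposite.opAddEquiv with
      map_smul' := fun _ _ => rfl }

variable {D : CochainComplex (ModuleCat.{u} (A ⊗[k] Bᵐᵒᵖ)) ℤ}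

lemma IsDualizingComplex.nonempty_iso_RHom (hD : IsDualizingComplex k D) :
    Nonempty (RHom k (overA k D) (leftRegular A) ≅ RHom k (overB k D) (rightRegular B)) := by
  obtain ⟨P, h₁, h₂⟩ := hD.biprojective
  obtain ⟨e₁⟩ := nonempty_iso_RHom_stalk (k := k) P.toLeft (Iso.refl (ModuleCat.of A A))
  obtain ⟨e₂⟩ := nonempty_iso_RHom_stalk (k := k) P.toRight (rightRegularIso B)
  have : (restrict (inA k A B) P.P).IsKProjective := P.toLeft.kProjective
  have : (restrict (inB k A B) P.P).IsKProjective := P.toRight.kProjective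
  obtain ⟨e⟩ := nonempty_iso_Q_homComplex_regular h₁ h₂
  exact ⟨e₁ ≪≫ e ≪≫ e₂.symm⟩

theorem IsDualizingComplex.injDim_le_of_left (hD : IsDualizingComplex k D) [IsNoetherianRing A]
    (hb : HomologicallyBounded (RHom k (overA k D) (leftRegular A))) (hA : AuslanderCondition A) :
    injDim (rightRegular A) ≤ pd (overA k D) + injDim (overB k D) ∧
      injDim (rightRegular B) ≤ pd (overA k D) + injDim (overB k D) ∧
      pd (overA k D) + injDim (overB k D) < ⊤ := by
  obtain ⟨P, h₁, h₂⟩ := hD.biprojective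
  obtain ⟨I⟩ := hD.biinjective
  obtain ⟨a, b, _, _⟩ := hD.bounded
  obtain ⟨s, _⟩ := P.bounded
  obtain ⟨t, u, _, _⟩ := I.bounded
  have := P.quasiIso
  have := I.quasiIso
  exact injDim_le_of_auslanderCondition (inA k A B) (inB k A B) P.π I.ι hA s t u a b hD.finite_left
    P.projective_left P.projective_right I.injective_right h₁ h₂ (Iso.refl _) hb
    (RingEquiv.refl Aᵐᵒᵖ) (M := ModuleCat.of Aᵐᵒᵖ A) (AddEquiv.refl A) (fun _ _ => rfl)
    (N := ModuleCat.of Bᵐᵒᵖ B) MulOpposite.opAddEquiv (fun _ _ => rfl)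

/-- The roles of `A` and `Bᵐᵒᵖ` are exchanged. The opposite of `Bᵐᵒᵖ` is identified with `B` by
`RingEquiv.opOp`, and the source bound now concerns `B` and the target bound `A`. -/
theorem IsDualizingComplex.injDim_le_of_right (hD : IsDualizingComplex k D)
    [IsNoetherianRing Bᵐᵒᵖ]
    (hb : HomologicallyBounded (RHom k (overB k D) (rightRegular B)))
    (hB : AuslanderCondition Bᵐᵒᵖ) :
    injDim (leftRegular A) ≤ pd (overB k D) + injDim (overA k D) ∧
      injDim (leftRegular B) ≤ pd (overB k D) + injDim (overA k D) ∧
      pd (overB k D) + injDim (overA k D) < ⊤ := by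
  obtain ⟨P, h₁, h₂⟩ := hD.biprojective
  obtain ⟨I⟩ := hD.biinjective
  obtain ⟨a, b, _, _⟩ := hD.bounded
  obtain ⟨s, _⟩ := P.bounded
  obtain ⟨t, u, _, _⟩ := I.bounded
  have := P.quasiIso
  have := I.quasiIso
  have H := injDim_le_of_auslanderCondition (inB k A B) (inA k A B) P.π I.ι hB s t u a b
    hD.finite_right P.projective_right P.projective_left I.injective_left h₂ h₁
    (rightRegularIso B) hb (RingEquiv.opOp B) (M := ModuleCat.of B B) MulOpposite.opAddEquiv
    (fun _ _ => rfl) (N := ModuleCat.of A A) (AddEquiv.refl A) (fun _ _ => rfl)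
  exact ⟨H.2.1, H.1, H.2.2⟩

lemma IsDualizingComplex.homologicallyBounded_left (hD : IsDualizingComplex k D)
    (hA : injDim (leftRegular A) < ⊤) :
    HomologicallyBounded (RHom k (overA k D) (leftRegular A)) := by
  obtain ⟨P, -, -⟩ := hD.biprojective
  obtain ⟨a, b, _, _⟩ := hD.bounded
  obtain ⟨s, _⟩ := P.bounded
  have := P.quasiIso
  have := restrictScalars_preservesHomology (inA k A B : A →+* A ⊗[k] Bᵐᵒᵖ)
  have := quasiIso_restrictMap (inA k A B) P.π
  have : (overA k D).IsGE a := (isGE_mapHomologicalComplex_iff _ D a).2 inferInstance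
  exact homologicallyBounded_RHom_of_injDim_lt_top (restrictMap (inA k A B) P.π) P.projective_left
    a s 0 hA

lemma IsDualizingComplex.homologicallyBounded_right (hD : IsDualizingComplex k D)
    (hB : injDim (rightRegular B) < ⊤) :
    HomologicallyBounded (RHom k (overB k D) (rightRegular B)) := by
  obtain ⟨P, -, -⟩ := hD.biprojective
  obtain ⟨a, b, _, _⟩ := hD.bounded
  obtain ⟨s, _⟩ := P.bounded
  have := P.quasiIso
  have := restrictScalars_preservesHomology (inB k A B : Bᵐᵒᵖ →+* A ⊗[k] Bᵐᵒᵖ)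
  have := quasiIso_restrictMap (inB k A B) P.π
  have : (overB k D).IsGE a := (isGE_mapHomologicalComplex_iff _ D a).2 inferInstance
  exact homologicallyBounded_RHom_of_injDim_lt_top (restrictMap (inB k A B) P.π) P.projective_right
    a s 0 hB

end DualizingComplexes

end

end ACRing

theorem proposition3p5 {k : Type v} [CommRing k] [HasDerivedCategory.{w} (ModuleCat.{u} k)] :
    (∀ (A B : Type u) [Ring A] [Ring B] [Algebra k A] [Algebra k B]
        [IsNoetherianRing A] [IsNoetherianRing Bᵐᵒᵖ]
        (D : CochainComplex (ModuleCat.{u} (A ⊗[k] Bᵐᵒᵖ)) ℤ), ACRing.IsDualizingComplex k D →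
      Nonempty (ACRing.RHom k (ACRing.overA k D) (ACRing.leftRegular A) ≅
        ACRing.RHom k (ACRing.overB k D) (ACRing.rightRegular B)) ∧
      (ACRing.HomologicallyBounded (ACRing.RHom k (ACRing.overA k D) (ACRing.leftRegular A)) →
        (ACRing.AuslanderCondition A →
          ACRing.injDim (ACRing.rightRegular A) ≤
            ACRing.pd (ACRing.overA k D) + ACRing.injDim (ACRing.overB k D) ∧
          ACRing.injDim (ACRing.rightRegular B) ≤
            ACRing.pd (ACRing.overA k D) + ACRing.injDim (ACRing.overB k D) ∧
          ACRing.pd (ACRing.overA k D) + ACRing.injDim (ACRing.overB k D) < ⊤) ∧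
        (ACRing.AuslanderCondition Bᵐᵒᵖ →
          ACRing.injDim (ACRing.leftRegular A) ≤
            ACRing.pd (ACRing.overB k D) + ACRing.injDim (ACRing.overA k D) ∧
          ACRing.injDim (ACRing.leftRegular B) ≤
            ACRing.pd (ACRing.overB k D) + ACRing.injDim (ACRing.overA k D) ∧
          ACRing.pd (ACRing.overB k D) + ACRing.injDim (ACRing.overA k D) < ⊤))) ∧
    (∀ (A : Type u) [Ring A] [Algebra k A] [IsNoetherianRing A] [IsNoetherianRing Aᵐᵒᵖ]
        (D : CochainComplex (ModuleCat.{u} (A ⊗[k] Aᵐᵒᵖ)) ℤ), ACRing.IsDualizingComplex k D →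
      ACRing.AuslanderCondition A → ACRing.AuslanderCondition Aᵐᵒᵖ →
      (ACRing.injDim (ACRing.leftRegular A) < ⊤ ↔
        ACRing.injDim (ACRing.rightRegular A) < ⊤)) := by

  refine ⟨fun A B _ _ _ _ _ _ D hD => ?_, fun A _ _ _ _ D hD hA hA' => ?_⟩
  · obtain ⟨e⟩ := hD.nonempty_iso_RHom
    exact ⟨⟨e⟩, fun hb => ⟨hD.injDim_le_of_left hb, hD.injDim_le_of_right (hb.of_iso e)⟩⟩
  · obtain ⟨e⟩ := hD.nonempty_iso_RHom
    constructor
    -- Finite injective dimension on one side makes `RHom` into the ring on that side bounded; the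
    -- bound obtained from it concerns the other side.
    · intro h
      obtain ⟨h₁, -, h₂⟩ := hD.injDim_le_of_left (hD.homologicallyBounded_left h) hA
      exact h₁.trans_lt h₂
    · intro h
      obtain ⟨h₁, -, h₂⟩ := hD.injDim_le_of_right (hD.homologicallyBounded_right h) hA'
      exact h₁.trans_lt h₂
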